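/- Large-penalty compensation for the two-local $[[6k,2k,2]]$ subsystem code. Setting. Let the system consist of $6k$ qubits labelled $L_i,B_i,R_i$, $1\le i\le 2k$. Let $\mathcal G$ be the gauge group generated by $X_{B_i}X_{R_i}$, $Z_{B_i}Z_{L_i}$ ($1\le i\le 2k$) and $X_{L_i}X_{L_{i+1}}$, $Z_{R_i}Z_{R_{i+1}}$ ($1\le i\le 2k-1$). The bare-logical operators are $\bar X_i=X_{B_i}X_{L_i}$ and $\bar Z_i=Z_{B_i}Z_{R_i}$; put $g^x_{ij}=X_{L_i}X_{L_j}$ and $g^z_{ij}=Z_{R_i}Z_{R_j}$. Let $G'$ be any finite set of X-type operators (products of Pauli $X$'s, with sign $+$) and Z-type operators (products of Pauli $Z$'s, with sign $+$) that generates $\mathcal G$. Let $H_p=-\sum_{g\in G'}g$, let $\Pi_0$ be the orthogonal projector onto the eigenspace of the least eigenvalue of $H_p$, and let $$\alpha^x_{ij}=\frac{\operatorname{tr}(\Pi_0 g^x_{ij})}{\operatorname{tr}\Pi_0},\qquad \alpha^z_{ij}=\frac{\operatorname{tr}(\Pi_0 g^z_{ij})}{\operatorname{tr}\Pi_0}$$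 be the ground-space expectations of the gauge operators. For real, possibly time-dependent, coefficients $a_i,b_i,c_{ij},d_{ij}$ let $$\bar H_s(t)=\sum_i a_i\bar X_i+\sum_i b_i\bar Z_i+\sum_{i,j}c_{ij}\bar X_i\bar X_j+\sum_{i,j}d_{ij}\bar Z_i\bar Z_j$$ be the encoded universal Hamiltonian and let $$\hat H_s(t)=\sum_i a_iX_{L_i}X_{B_i}+\sum_i b_iZ_{B_i}Z_{R_i}+\sum_{i,j}c'_{ij}X_{B_i}X_{B_j}+\sum_{i,j}d'_{ij}Z_{B_i}Z_{B_j}$$ be the two-local physical Hamiltonian. Claim. 1. For all $i,j$: $g^x_{ij},g^z_{ij}\in\mathcal G$, $X_{B_i}X_{B_j}=\bar X_i\bar X_j\,g^x_{ij}$ and $Z_{B_i}Z_{B_j}=\bar Z_i\bar Z_j\,g^z_{ij}$. 2. For all $i,j$: $\Pi_0g^x_{ij}\Pi_0=\alpha^x_{ij}\Pi_0$ and $\Pi_0g^z_{ij}\Pi_0=\alpha^z_{ij}\Pi_0$, with $\alpha^x_{ij}>0$ and $\alpha^z_{ij}>0$. 3. With the choice $c'_{ij}=c_{ij}/\alpha^x_{ij}$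 and $d'_{ij}=d_{ij}/\alpha^z_{ij}$, for all coefficient functions and all times $t$, $$\Pi_0\hat H_s(t)\Pi_0=\Pi_0\bar H_s(t)\Pi_0=\Pi_0\bar H_s(t).$$ 4. For every bath space and all linear operators $B_{q,\sigma}$ on it, the one-local system–bath coupling $H_{SB}=\sum_q\sum_{\sigma\in\{X,Y,Z\}}\sigma_q\otimes B_{q,\sigma}$ satisfies $(\Pi_0\otimes I)\,H_{SB}\,(\Pi_0\otimes I)=0$. -/

import Mathlib

open scoped TensorProduct

noncomputable section

/-- The three qubits `L`, `B`, `R` that make up one block of the code. -/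
inductive Site
  | L
  | B
  | R
  deriving DecidableEq

instance : Fintype Site := ⟨{Site.L, Site.B, Site.R}, fun s => by cases s <;> simp⟩

/-- The three nontrivial Pauli labels. -/
inductive Pauli
  | X
  | Y
  | Z
  deriving DecidableEq

instance : Fintype Pauli := ⟨{Pauli.X, Pauli.Y, Pauli.Z}, fun p => by cases p <;> simp⟩

/-- The single-qubit Pauli matrices. -/
def Pauli.mat : Pauli → Matrix (Fin 2) (Fin 2) ℂ
  | .X => !![0, 1; 1, 0]
  | .Y => !![0, -Complex.I; Complex.I, 0]
  | .Z => !![1, 0; 0, -1]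

/-- The `6k` physical qubits: `L_i`, `B_i`, `R_i` for `2k` values of `i`. -/
abbrev Qubit (k : ℕ) : Type := Site × Fin (2 * k)

/-- Labels of the computational basis of `(ℂ²)^{⊗ 6k}`. -/
abbrev Config (k : ℕ) : Type := Qubit k → Fin 2

/-- Operators on `(ℂ²)^{⊗ 6k}`, as matrices in the computational basis. -/
abbrev Op (k : ℕ) : Type := Matrix (Config k) (Config k) ℂ

/-- The tensor product `⨂_q M q` of single-qubit operators. -/
def tensorOp {k : ℕ} (M : Qubit k → Matrix (Fin 2) (Fin 2) ℂ) : Op k :=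
  Matrix.of fun s t => ∏ q, M q (s q) (t q)

/-- The Pauli matrix `p` on every qubit of `S`, and the identity on all other qubits. -/
def pauliString {k : ℕ} (p : Pauli) (S : Finset (Qubit k)) : Op k :=
  tensorOp fun q => if q ∈ S then p.mat else 1

/-- The one-local Pauli operator `p_q`. -/
def pauliAt {k : ℕ} (p : Pauli) (q : Qubit k) : Op k :=
  pauliString p {q}

/-- `X_q` -/
abbrev opX {k : ℕ} (s : Site) (i : Fin (2 * k)) : Op k := pauliAt Pauli.X (s, i)

/-- `Z_q` -/
abbrev opZ {k : ℕ} (s : Site) (i : Fin (2 * k)) : Op k := pauliAt Pauli.Z (s, i)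

/-- The group generated by a set of invertible operators. -/
def groupGenerated {k : ℕ} (S : Set (Op k)) : Subgroup (Op k)ˣ :=
  Subgroup.closure {u | (u : Op k) ∈ S}

/-- The `8k - 2` two-local generators `X_{B_i} X_{R_i}`, `X_{L_i} X_{L_{i+1}}`,
`Z_{B_i} Z_{L_i}`, `Z_{R_i} Z_{R_{i+1}}` of the gauge group of the `[[6k, 2k, 2]]` code. -/
def gaugeGenerators (k : ℕ) : Set (Op k) :=
  {g | (∃ i : Fin (2 * k), g = opX .B i * opX .R i) ∨
    (∃ i j : Fin (2 * k), (j : ℕ) = i + 1 ∧ g = opX .L i * opX .L j) ∨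
    (∃ i : Fin (2 * k), g = opZ .B i * opZ .L i) ∨
    (∃ i j : Fin (2 * k), (j : ℕ) = i + 1 ∧ g = opZ .R i * opZ .R j)}

/-- The (non-Abelian) gauge group of the code. -/
def gaugeGroup (k : ℕ) : Subgroup (Op k)ˣ := groupGenerated (gaugeGenerators k)

/-- `G'` is a finite set of X-type operators (products of `X_q`, with sign `+`) and Z-type
operators (products of `Z_q`, with sign `+`) that generates the gauge group. -/
structure IsPenaltySet {k : ℕ} (G' : Finset (Op k)) : Prop where
  type_XZ : ∀ g ∈ G', (∃ S, g = pauliString Pauli.X S) ∨ (∃ S, g = pauliString Pauli.Z S)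
  generates : groupGenerated (G' : Set (Op k)) = gaugeGroup k

/-- The penalty Hamiltonian `H_p = - ∑_{g ∈ G'} g`. -/
def penaltyHamiltonian {k : ℕ} (G' : Finset (Op k)) : Op k := -∑ g ∈ G', g

/-- The least eigenvalue of a Hermitian operator. -/
def groundEnergy {k : ℕ} (H : Op k) : ℝ :=
  sInf {E : ℝ | Module.End.HasEigenvalue (Matrix.toEuclideanLin H) (E : ℂ)}

/-- The eigenspace of the least eigenvalue. -/
def groundSpace {k : ℕ} (H : Op k) : Submodule ℂ (EuclideanSpace ℂ (Config k)) :=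
  Module.End.eigenspace (Matrix.toEuclideanLin H) (groundEnergy H : ℂ)

/-- The orthogonal projector onto the ground subspace, as a matrix. -/
def groundProjection {k : ℕ} (H : Op k) : Op k :=
  Matrix.toEuclideanLin.symm
    ((groundSpace H).starProjection :
      EuclideanSpace ℂ (Config k) →ₗ[ℂ] EuclideanSpace ℂ (Config k))

/-- The expectation `tr(Π₀ g) / tr(Π₀)` of a Hermitian operator `g` in the ground subspace
of `H`. -/
def groundExpectation {k : ℕ} (H g : Op k) : ℝ :=
  ((groundProjection H * g).trace / (groundProjection H).trace).re

/-- The bare-logical operator `X̄_i = X_{B_i} X_{L_i}`. -/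
def logicalX {k : ℕ} (i : Fin (2 * k)) : Op k := opX .B i * opX .L i

/-- The bare-logical operator `Z̄_i = Z_{B_i} Z_{R_i}`. -/
def logicalZ {k : ℕ} (i : Fin (2 * k)) : Op k := opZ .B i * opZ .R i

/-- The gauge operator `g^x_{ij} = X_{L_i} X_{L_j}`. -/
def gaugeX {k : ℕ} (i j : Fin (2 * k)) : Op k := opX .L i * opX .L j

/-- The gauge operator `g^z_{ij} = Z_{R_i} Z_{R_j}`. -/
def gaugeZ {k : ℕ} (i j : Fin (2 * k)) : Op k := opZ .R i * opZ .R j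

/-- The encoded Hamiltonian
`H̄ = ∑ a_i X̄_i + ∑ b_i Z̄_i + ∑ c_{ij} X̄_i X̄_j + ∑ d_{ij} Z̄_i Z̄_j`. -/
def encodedHamiltonian {k : ℕ} (a b : Fin (2 * k) → ℝ) (c d : Fin (2 * k) → Fin (2 * k) → ℝ) :
    Op k :=
  ∑ i, (a i : ℂ) • logicalX i + ∑ i, (b i : ℂ) • logicalZ i +
    ∑ i, ∑ j, (c i j : ℂ) • (logicalX i * logicalX j) +
    ∑ i, ∑ j, (d i j : ℂ) • (logicalZ i * logicalZ j)

/-- The two-local physical Hamiltonian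
`Ĥ = ∑ a_i X_{L_i} X_{B_i} + ∑ b_i Z_{B_i} Z_{R_i} + ∑ c'_{ij} X_{B_i} X_{B_j}
+ ∑ d'_{ij} Z_{B_i} Z_{B_j}`. -/
def physicalHamiltonian {k : ℕ} (a b : Fin (2 * k) → ℝ)
    (c' d' : Fin (2 * k) → Fin (2 * k) → ℝ) : Op k :=
  ∑ i, (a i : ℂ) • (opX .L i * opX .B i) + ∑ i, (b i : ℂ) • (opZ .B i * opZ .R i) +
    ∑ i, ∑ j, (c' i j : ℂ) • (opX .B i * opX .B j) +
    ∑ i, ∑ j, (d' i j : ℂ) • (opZ .B i * opZ .B j)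

/-- The operator `A ⊗ B` on system and bath. The bath `V` may be any complex vector space, in
particular any Hilbert space: the system is finite-dimensional, so that the algebraic tensor
product is then also the Hilbert space tensor product. -/
def systemBath {k : ℕ} {V : Type*} [AddCommGroup V] [Module ℂ V] (A : Op k)
    (B : Module.End ℂ V) : Module.End ℂ ((Config k → ℂ) ⊗[ℂ] V) :=
  TensorProduct.map (Matrix.toLin' A) B

/-- The one-local system-bath coupling `H_SB = ∑_q ∑_{p ∈ {X, Y, Z}} p_q ⊗ B_{q,p}`. -/
def systemBathCoupling {k : ℕ} {V : Type*} [AddCommGroup V] [Module ℂ V]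
    (B : Qubit k → Pauli → Module.End ℂ V) : Module.End ℂ ((Config k → ℂ) ⊗[ℂ] V) :=
  ∑ q, ∑ p, systemBath (pauliAt p q) (B q p)

end

/-! The argument is Perron–Frobenius on orbits of X-type shifts, combined with a Hadamard duality.
In the computational basis the X-type elements of `G'` translate configurations by bit vectors and
the Z-type elements are diagonal signs. Hence `K = H_p - E₀` is real, positive semidefinite and has
nonpositive off-diagonal entries. If the real part of a kernel vector is nonpositive at one
configuration, it is nonpositive along the whole orbit of the X-type gauge shifts
(`IsPenaltySet.re_apply_add_nonpos`). So a kernel vector vanishing at one point of an orbit vanishes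
on the orbit (`IsPenaltySet.apply_add_eq_zero`), and one that is odd under a shift is zero there
(`IsPenaltySet.apply_eq_zero_of_neg`).

The stabilizer `X⊗⋯⊗X` is itself an X-type gauge operator, so oddness is impossible and it acts as
`+1` on the ground space. The Hadamard transform composed with `L ↔ R` preserves the gauge group and
exchanges the two types, so `Z⊗⋯⊗Z` acts as `+1` too. Every one-local Pauli anticommutes with one of
the two, which removes the bath coupling.

For `Q = P g P` with `g = X_{L_i} X_{L_j}`, each column of `Q` is a multiple of that of `P`, since
an orbit carries at most one kernel direction. Hermiticity makes the multiple constant on an orbit.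
The Z stabilizer confines `P` to even configurations, and there bare-logical X operators, which
commute with `P` and `Q`, connect all orbits. Thus `Q = c P`, and `c > 0` because the relevant
entries of `P` have positive real part. Duality gives the Z case. The compensation is then algebra,
since `P` commutes with the bare logicals. -/

noncomputable section

/-! ### Sign characters on bit vectors. -/

/-- The value `(-1)^{ab}` for bits `a`, `b`. -/
def bitSign (a b : Fin 2) : ℂ := if a = 1 ∧ b = 1 then -1 else 1

theorem bitSign_add_right (a b c : Fin 2) : bitSign a (b + c) = bitSign a b * bitSign a c := by
  fin_cases a <;> fin_cases b <;> fin_cases c <;> simp [bitSign]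

theorem bitSign_comm (a b : Fin 2) : bitSign a b = bitSign b a := by
  simp only [bitSign, and_comm]

@[simp] theorem bitSign_zero_left (a : Fin 2) : bitSign 0 a = 1 := by simp [bitSign]

@[simp] theorem bitSign_zero_right (a : Fin 2) : bitSign a 0 = 1 := by simp [bitSign]

theorem bit_add_self (a : Fin 2) : a + a = 0 := by
  fin_cases a <;> rfl

variable {k : ℕ}

theorem config_add_self (v : Config k) : v + v = 0 := funext fun q => bit_add_self (v q)

theorem config_eq_add_iff (s t v : Config k) : s = t + v ↔ t = s + v := by
  constructor <;> rintro rfl <;> rw [add_assoc, config_add_self, add_zero]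

/-- The bilinear sign `(-1)^{⟨w, s⟩}`. -/
def dotSign (w s : Config k) : ℂ := ∏ q, bitSign (w q) (s q)

theorem dotSign_add_right (w s t : Config k) :
    dotSign w (s + t) = dotSign w s * dotSign w t := by
  simp only [dotSign, Pi.add_apply, bitSign_add_right, Finset.prod_mul_distrib]

theorem dotSign_comm (w s : Config k) : dotSign w s = dotSign s w := by
  simp only [dotSign, bitSign_comm]

theorem dotSign_add_left (w w' s : Config k) :
    dotSign (w + w') s = dotSign w s * dotSign w' s := by
  rw [dotSign_comm, dotSign_add_right, dotSign_comm s, dotSign_comm s]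

@[simp] theorem dotSign_zero_right (w : Config k) : dotSign w 0 = 1 := by simp [dotSign]

@[simp] theorem dotSign_zero_left (w : Config k) : dotSign 0 w = 1 := by simp [dotSign]

theorem dotSign_single (q : Qubit k) (s : Config k) :
    dotSign (Pi.single q 1) s = bitSign 1 (s q) := by
  unfold dotSign
  rw [Finset.prod_eq_single q]
  · simp
  · intro b _ hb; simp [Pi.single_eq_of_ne hb]
  · simp

theorem dotSign_mul_self (w s : Config k) : dotSign w s * dotSign w s = 1 := by
  rw [← dotSign_add_right, config_add_self, dotSign_zero_right]

theorem dotSign_eq_one_or (w s : Config k) : dotSign w s = 1 ∨ dotSign w s = -1 :=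
  mul_self_eq_one_iff.mp (dotSign_mul_self w s)

theorem star_dotSign (w s : Config k) : star (dotSign w s) = dotSign w s := by
  rcases dotSign_eq_one_or w s with h | h <;> simp [h]

/-! ### X-type and Z-type operators as translations and characters. -/

/-- The X-type operator with support vector `v`. -/
def xOp (v : Config k) : Op k := Matrix.of fun s t => if s = t + v then 1 else 0

/-- The Z-type operator with support vector `w`. -/
def zOp (w : Config k) : Op k := Matrix.diagonal (dotSign w)

theorem xOp_mul_apply (v : Config k) (A : Op k) (s t : Config k) :
    (xOp v * A) s t = A (s + v) t := by
  simp only [Matrix.mul_apply, xOp, Matrix.of_apply, config_eq_add_iff s]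
  simp

theorem mul_xOp_apply (v : Config k) (A : Op k) (s t : Config k) :
    (A * xOp v) s t = A s (t + v) := by
  simp [Matrix.mul_apply, xOp]

theorem zOp_mul_apply (w : Config k) (A : Op k) (s t : Config k) :
    (zOp w * A) s t = dotSign w s * A s t := by
  simp [zOp]

theorem mul_zOp_apply (w : Config k) (A : Op k) (s t : Config k) :
    (A * zOp w) s t = A s t * dotSign w t := by
  simp [zOp]

theorem xOp_zero : xOp (0 : Config k) = 1 := by
  ext s t; simp [xOp, Matrix.one_apply]

theorem zOp_zero : zOp (0 : Config k) = 1 := by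
  ext s t; simp [zOp, Matrix.one_apply, Matrix.diagonal_apply]

theorem xOp_mul (v w : Config k) : xOp v * xOp w = xOp (v + w) := by
  ext s t
  rw [mul_xOp_apply]
  simp only [xOp, Matrix.of_apply]
  rw [add_assoc, add_comm w v]

theorem zOp_mul (v w : Config k) : zOp v * zOp w = zOp (v + w) := by
  simp only [zOp, Matrix.diagonal_mul_diagonal]
  congr 1; ext s; rw [dotSign_add_left]

theorem xOp_mul_self (v : Config k) : xOp v * xOp v = 1 := by
  rw [xOp_mul, config_add_self, xOp_zero]

theorem zOp_mul_self (v : Config k) : zOp v * zOp v = 1 := by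
  rw [zOp_mul, config_add_self, zOp_zero]

theorem zOp_mul_xOp (v w : Config k) : zOp w * xOp v = dotSign w v • (xOp v * zOp w) := by
  ext s t
  rw [zOp_mul_apply, Matrix.smul_apply, mul_zOp_apply]
  simp only [xOp, Matrix.of_apply, smul_eq_mul]
  split_ifs with h
  · rw [h, dotSign_add_right]; ring
  · ring

theorem xOp_isHermitian (v : Config k) : (xOp v).IsHermitian := by
  ext s t
  simp only [Matrix.conjTranspose_apply, xOp, Matrix.of_apply, config_eq_add_iff t]
  split_ifs <;> simp

theorem zOp_isHermitian (v : Config k) : (zOp v).IsHermitian := by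
  ext s t
  simp only [Matrix.conjTranspose_apply, zOp, Matrix.diagonal_apply]
  by_cases h : t = s
  · subst h; simpa using star_dotSign v t
  · rw [if_neg h, if_neg (Ne.symm h)]; simp

theorem commute_xOp_xOp (v w : Config k) : Commute (xOp v) (xOp w) := by
  rw [commute_iff_eq, xOp_mul, xOp_mul, add_comm]

theorem commute_zOp_zOp (v w : Config k) : Commute (zOp v) (zOp w) := by
  rw [commute_iff_eq, zOp_mul, zOp_mul, add_comm]

theorem commute_zOp_xOp {v w : Config k} (h : dotSign w v = 1) : Commute (zOp w) (xOp v) := by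
  rw [commute_iff_eq, zOp_mul_xOp, h, one_smul]

theorem pauliString_X (S : Finset (Qubit k)) :
    pauliString Pauli.X S = xOp fun q => if q ∈ S then 1 else 0 := by
  ext s t
  have key : ∀ q, (if q ∈ S then Pauli.X.mat else 1 : Matrix (Fin 2) (Fin 2) ℂ) (s q) (t q) =
      if s q = t q + (if q ∈ S then 1 else 0) then 1 else 0 := by
    intro q
    generalize s q = a
    generalize t q = b
    by_cases h : q ∈ S <;> simp only [h, if_true, if_false] <;>
      fin_cases a <;> fin_cases b <;> simp [Pauli.mat]
  simp only [pauliString, tensorOp, Matrix.of_apply, xOp, key]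
  rw [Finset.prod_ite_zero]
  simp [funext_iff]

theorem pauliString_Z (S : Finset (Qubit k)) :
    pauliString Pauli.Z S = zOp fun q => if q ∈ S then 1 else 0 := by
  ext s t
  have key : ∀ q, (if q ∈ S then Pauli.Z.mat else 1 : Matrix (Fin 2) (Fin 2) ℂ) (s q) (t q) =
      if s q = t q then bitSign (if q ∈ S then 1 else 0) (s q) else 0 := by
    intro q
    generalize s q = a
    generalize t q = b
    by_cases h : q ∈ S <;> simp only [h, if_true, if_false] <;>
      fin_cases a <;> fin_cases b <;> simp [Pauli.mat, bitSign]
  simp only [pauliString, tensorOp, Matrix.of_apply, zOp, key, Matrix.diagonal_apply, dotSign]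
  rw [Finset.prod_ite_zero]
  simp [funext_iff]

theorem xOp_eq_pauliString (v : Config k) :
    xOp v = pauliString Pauli.X (Finset.univ.filter fun q => v q = 1) := by
  rw [pauliString_X]
  congr 1; funext q
  simp only [Finset.mem_filter, Finset.mem_univ, true_and]
  generalize v q = a
  fin_cases a <;> simp

theorem zOp_eq_pauliString (v : Config k) :
    zOp v = pauliString Pauli.Z (Finset.univ.filter fun q => v q = 1) := by
  rw [pauliString_Z]
  congr 1; funext q
  simp only [Finset.mem_filter, Finset.mem_univ, true_and]
  generalize v q = a
  fin_cases a <;> simp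

theorem opX_eq (s : Site) (i : Fin (2 * k)) : opX s i = xOp (Pi.single (s, i) 1) := by
  rw [opX, pauliAt, pauliString_X]
  congr 1; ext q
  simp [Pi.single_apply]

theorem opZ_eq (s : Site) (i : Fin (2 * k)) : opZ s i = zOp (Pi.single (s, i) 1) := by
  rw [opZ, pauliAt, pauliString_Z]
  congr 1; ext q
  simp [Pi.single_apply]

/-- The indicator vector of a pair of qubits. -/
def pairVec (q r : Qubit k) : Config k := Pi.single q 1 + Pi.single r 1

theorem pairVec_comm (q r : Qubit k) : pairVec q r = pairVec r q := add_comm _ _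

theorem opX_mul_opX (s s' : Site) (i j : Fin (2 * k)) :
    opX s i * opX s' j = xOp (pairVec (s, i) (s', j)) := by
  rw [opX_eq, opX_eq, xOp_mul, pairVec]

theorem opZ_mul_opZ (s s' : Site) (i j : Fin (2 * k)) :
    opZ s i * opZ s' j = zOp (pairVec (s, i) (s', j)) := by
  rw [opZ_eq, opZ_eq, zOp_mul, pairVec]

theorem dotSign_pairVec (q r : Qubit k) (s : Config k) :
    dotSign (pairVec q r) s = bitSign 1 (s q + s r) := by
  rw [pairVec, dotSign_add_left, dotSign_single, dotSign_single, bitSign_add_right]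

theorem dotSign_one (s : Config k) : dotSign 1 s = bitSign 1 (∑ q, s q) := by
  unfold dotSign
  induction (Finset.univ : Finset (Qubit k)) using Finset.induction_on with
  | empty => simp
  | insert a S ha ih => rw [Finset.prod_insert ha, Finset.sum_insert ha, bitSign_add_right, ih]; rfl

/-! ### The lattice of X-type gauge shifts. -/

/-- `xOp v` as a unit. -/
def xUnit (v : Config k) : (Op k)ˣ := ⟨xOp v, xOp v, xOp_mul_self v, xOp_mul_self v⟩

/-- `zOp w` as a unit. -/
def zUnit (w : Config k) : (Op k)ˣ := ⟨zOp w, zOp w, zOp_mul_self w, zOp_mul_self w⟩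

/-- The support vectors of X-type gauge operators. -/
def xShifts (k : ℕ) : AddSubgroup (Config k) where
  carrier := {v | xUnit v ∈ gaugeGroup k}
  add_mem' {v w} hv hw := by
    have : xUnit (v + w) = xUnit v * xUnit w := Units.ext (xOp_mul v w).symm
    simpa only [Set.mem_ofPred_eq, this] using mul_mem hv hw
  zero_mem' := by
    have : xUnit (0 : Config k) = 1 := Units.ext xOp_zero
    simp only [Set.mem_ofPred_eq, this, one_mem]
  neg_mem' {v} hv := by rwa [neg_eq_of_add_eq_zero_left (config_add_self v)]

theorem mem_xShifts_of_generator {v : Config k} (h : xOp v ∈ gaugeGenerators k) :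
    v ∈ xShifts k := Subgroup.subset_closure h

theorem pairVec_BR_mem (i : Fin (2 * k)) : pairVec (.B, i) (.R, i) ∈ xShifts k :=
  mem_xShifts_of_generator (.inl ⟨i, (opX_mul_opX ..).symm⟩)

theorem pairVec_self (q : Qubit k) : pairVec q q = 0 := config_add_self _

theorem pairVec_add (p q r : Qubit k) : pairVec p q + pairVec q r = pairVec p r := by
  simp only [pairVec]
  rw [add_assoc, ← add_assoc (Pi.single q 1) (Pi.single q 1), config_add_self, zero_add]

/-- Neighbouring generators telescope along the chain of `L` qubits. -/
theorem pairVec_LL_mem (i j : Fin (2 * k)) : pairVec (.L, i) (.L, j) ∈ xShifts k := by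
  have aux : ∀ n : ℕ, ∀ i j : Fin (2 * k), (j : ℕ) = i + n →
      pairVec (.L, i) (.L, j) ∈ xShifts k := by
    intro n
    induction n with
    | zero =>
      intro i j h
      obtain rfl : j = i := Fin.ext h
      rw [pairVec_self]; exact zero_mem _
    | succ n ih =>
      intro i j h
      have hm : (i : ℕ) + n < 2 * k := by omega
      rw [← pairVec_add _ (.L, ⟨i + n, hm⟩)]
      refine add_mem (ih i _ rfl) (mem_xShifts_of_generator (.inr (.inl ?_)))
      exact ⟨_, j, by simp; omega, (opX_mul_opX ..).symm⟩
  rcases le_total (i : ℕ) j with h | h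
  · exact aux (j - i) i j (by omega)
  · rw [pairVec_comm]; exact aux (i - j) j i (by omega)

theorem pairVec_apply (q r p : Qubit k) :
    pairVec q r p = (if p = q then 1 else 0) + (if p = r then 1 else 0) := by
  simp [pairVec, Pi.single_apply]

/-- The `B`–`R` generators account for the `B` and `R` bits; an even set of `L` bits is a sum of
pairs through a fixed base point `i₀`. -/
theorem mem_xShifts_of_eq {v : Config k} (hBR : ∀ i, v (.B, i) = v (.R, i))
    (hL : ∑ i, v (.L, i) = 0) : v ∈ xShifts k := by
  rcases isEmpty_or_nonempty (Fin (2 * k)) with he | ⟨⟨i₀⟩⟩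
  · have : v = 0 := funext fun q => (he.false q.2).elim
    rw [this]; exact zero_mem _
  have hv : v = ∑ i, (if v (.R, i) = 1 then pairVec (.B, i) (.R, i) else 0) +
      ∑ i, (if v (.L, i) = 1 then pairVec (.L, i) (.L, i₀) else 0) := by
    have e : ∀ (a c : Fin 2), (if a = 1 then c else 0) = a * c := by decide
    have e1 : ∀ (a : Fin 2), (if a = 1 then 1 else 0) = a := by decide
    funext ⟨s, j⟩
    simp only [Pi.add_apply, Finset.sum_apply, ite_apply, Pi.zero_apply, pairVec_apply,
      Prod.mk.injEq]
    cases s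
    · have : ∀ i, (if v (.L, i) = 1 then (if j = i then 1 else 0) + (if j = i₀ then 1 else 0)
          else 0 : Fin 2) = (if j = i then v (.L, i) else 0) +
            (if j = i₀ then v (.L, i) else 0) := by
        intro i
        generalize v (.L, i) = a
        fin_cases a <;> simp
      simp only [reduceCtorEq, false_and, true_and, if_false, add_zero, ite_self,
        Finset.sum_const_zero, zero_add, this, Finset.sum_add_distrib]
      -- At the base point the pairs add an extra `∑ v (.L, i)`, which `hL` makes zero.
      by_cases hj : j = i₀ <;> simp [hj, hL]
    · have : ∀ i, (if v (.R, i) = 1 then (if j = i then 1 else 0) else 0 : Fin 2) =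
          if j = i then v (.R, i) else 0 := by
        intro i
        generalize v (.R, i) = a
        fin_cases a <;> simp
      simp [this, hBR]
    · have : ∀ i, (if v (.R, i) = 1 then (if j = i then 1 else 0) else 0 : Fin 2) =
          if j = i then v (.R, i) else 0 := by
        intro i
        generalize v (.R, i) = a
        fin_cases a <;> simp
      simp [this]
  rw [hv]
  refine add_mem (sum_mem fun i _ => ?_) (sum_mem fun i _ => ?_)
  · split_ifs
    · exact pairVec_BR_mem i
    · exact zero_mem _
  · split_ifs
    · exact pairVec_LL_mem i i₀
    · exact zero_mem _

theorem sum_two_mul_eq_zero (a : Fin 2) : ∑ _i : Fin (2 * k), a = 0 := by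
  rw [Finset.sum_const, Finset.card_univ, Fintype.card_fin, mul_comm, mul_nsmul, two_nsmul,
    ← nsmul_add, bit_add_self, nsmul_zero]

/-- The number `2k` of blocks is even, so the all-ones vector has even `L` parity. -/
theorem one_mem_xShifts : (1 : Config k) ∈ xShifts k :=
  mem_xShifts_of_eq (fun _ => rfl) (sum_two_mul_eq_zero 1)

/-! ### Operators commuting with the gauge group. -/

theorem commute_of_mem_gaugeGroup {C : Op k} (hC : ∀ g ∈ gaugeGenerators k, Commute g C)
    {u : (Op k)ˣ} (hu : u ∈ gaugeGroup k) : Commute (u : Op k) C := by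
  induction hu using Subgroup.closure_induction with
  | mem x hx => exact hC _ hx
  | one => exact Commute.one_left C
  | mul x y _ _ hx hy => rw [Units.val_mul]; exact hx.mul_left hy
  | inv x _ hx => exact hx.units_inv_left

theorem forall_generators {p : Op k → Prop}
    (hBR : ∀ i, p (xOp (pairVec (.B, i) (.R, i))))
    (hLL : ∀ i j : Fin (2 * k), (j : ℕ) = i + 1 → p (xOp (pairVec (.L, i) (.L, j))))
    (hBL : ∀ i, p (zOp (pairVec (.B, i) (.L, i))))
    (hRR : ∀ i j : Fin (2 * k), (j : ℕ) = i + 1 → p (zOp (pairVec (.R, i) (.R, j)))) :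
    ∀ g ∈ gaugeGenerators k, p g := by
  rintro g (⟨i, rfl⟩ | ⟨i, j, h, rfl⟩ | ⟨i, rfl⟩ | ⟨i, j, h, rfl⟩)
  · rw [opX_mul_opX]; exact hBR i
  · rw [opX_mul_opX]; exact hLL i j h
  · rw [opZ_mul_opZ]; exact hBL i
  · rw [opZ_mul_opZ]; exact hRR i j h

/-- The hypotheses say that `v` meets each Z generator in an even number of qubits. They cover both
the bare-logical X operators and the stabilizer `v = 1`. -/
theorem commute_xOp_generators {v : Config k} (hBL : ∀ i, v (.B, i) = v (.L, i))
    (hR : ∀ i j, v (.R, i) = v (.R, j)) : ∀ g ∈ gaugeGenerators k, Commute g (xOp v) := by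
  refine forall_generators (fun i => commute_xOp_xOp _ _) (fun i j _ => commute_xOp_xOp _ _)
    (fun i => commute_zOp_xOp ?_) (fun i j _ => commute_zOp_xOp ?_)
  · rw [dotSign_pairVec, hBL, bit_add_self, bitSign_zero_right]
  · rw [dotSign_pairVec, hR i j, bit_add_self, bitSign_zero_right]

theorem commute_zOp_generators {w : Config k} (hBR : ∀ i, w (.B, i) = w (.R, i))
    (hL : ∀ i j, w (.L, i) = w (.L, j)) : ∀ g ∈ gaugeGenerators k, Commute g (zOp w) := by
  have e : ∀ v, dotSign v w = 1 → Commute (xOp v) (zOp w) := fun v h =>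
    (commute_zOp_xOp (by rwa [dotSign_comm])).symm
  refine forall_generators (fun i => e _ ?_) (fun i j _ => e _ ?_)
    (fun i => commute_zOp_zOp _ _) (fun i j _ => commute_zOp_zOp _ _)
  · rw [dotSign_pairVec, hBR, bit_add_self, bitSign_zero_right]
  · rw [dotSign_pairVec, hL i j, bit_add_self, bitSign_zero_right]

theorem eq_zero_of_bitSign_one {a : Fin 2} (h : bitSign 1 a = 1) : a = 0 := by
  fin_cases a
  · rfl
  · norm_num [bitSign] at h

theorem sum_eq_zero_of_dotSign_one {s : Config k} (h : dotSign 1 s = 1) :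
    ∑ i, (s (.L, i) + (s (.B, i) + s (.R, i))) = 0 := by
  rw [dotSign_one] at h
  have h2 := eq_zero_of_bitSign_one h
  have hu : (Finset.univ : Finset Site) = {.L, .B, .R} := rfl
  rwa [Fintype.sum_prod_type, hu, Finset.sum_insert (by simp), Finset.sum_insert (by simp),
    Finset.sum_singleton, ← Finset.sum_add_distrib, ← Finset.sum_add_distrib] at h2

/-- A shift is an X-type gauge operator if it is invisible to the bare-logical Z operators and
to the Z stabilizer. -/
theorem mem_xShifts_of_dotSign {v : Config k}
    (h : ∀ w : Config k, (∀ i, w (.B, i) = w (.R, i)) → (∀ i j, w (.L, i) = w (.L, j)) →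
      dotSign w v = 1) : v ∈ xShifts k := by
  have hBR : ∀ i, v (.B, i) = v (.R, i) := by
    intro i
    -- Testing against the bare-logical Z of block `i` equates the `B` and `R` bits; the all-ones
    -- test below then gives the `L` parity.
    have h1 := h (pairVec (.B, i) (.R, i)) (fun j => by simp [pairVec_apply])
      (fun j l => by simp [pairVec_apply])
    rw [dotSign_pairVec] at h1
    have h2 := eq_zero_of_bitSign_one h1
    revert h2
    generalize v (.B, i) = a
    generalize v (.R, i) = b
    revert a b; decide
  refine mem_xShifts_of_eq hBR ?_
  simpa [hBR, bit_add_self] using sum_eq_zero_of_dotSign_one (h 1 (fun _ => rfl) fun _ _ => rfl)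

/-! ### Kernels of positive semidefinite matrices and Perron–Frobenius. -/

section Kernel
open scoped ComplexOrder
open Matrix

variable {n : Type*} [Fintype n]

/-- `P` is the orthogonal projection onto the kernel of the positive semidefinite matrix `K`,
and this kernel is nonzero. -/
structure IsKernelProjection (K P : Matrix n n ℂ) : Prop where
  posSemidef : K.PosSemidef
  isHermitian : P.IsHermitian
  mul_self : P * P = P
  ne_zero : P ≠ 0
  mul_eq_zero : K * P = 0
  mul_eq_of_mul_eq_zero : ∀ A : Matrix n n ℂ, K * A = 0 → P * A = A

theorem IsKernelProjection.mul_mul_eq {K P C : Matrix n n ℂ} (h : IsKernelProjection K P)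
    (hC : Commute K C) : P * C * P = C * P := by
  rw [Matrix.mul_assoc]
  refine h.mul_eq_of_mul_eq_zero _ ?_
  rw [← Matrix.mul_assoc, hC.eq, Matrix.mul_assoc, h.mul_eq_zero, Matrix.mul_zero]

theorem IsKernelProjection.commute {K P C : Matrix n n ℂ} (h : IsKernelProjection K P)
    (hC : Commute K C) (hC' : C.IsHermitian) : Commute P C := by
  have h1 := h.mul_mul_eq hC
  have h2 := congrArg conjTranspose h1
  simp only [conjTranspose_mul, h.isHermitian.eq, hC'.eq] at h2
  rw [commute_iff_eq, ← h2, ← Matrix.mul_assoc, h1]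

/-- Real positive semidefinite matrices with nonpositive off-diagonal entries preserve the kernel
under taking absolute values. -/
theorem Matrix.PosSemidef.mulVec_abs_eq_zero {A : Matrix n n ℝ} (hA : A.PosSemidef)
    (hoff : ∀ s t, s ≠ t → A s t ≤ 0) {v : n → ℝ} (hv : A *ᵥ v = 0) : A *ᵥ |v| = 0 := by
  -- It suffices that the quadratic form vanishes at `|v|`: its diagonal part is unchanged and its
  -- off-diagonal part can only decrease, so it is at most its value `0` at `v`.
  rw [← hA.dotProduct_mulVec_zero_iff]
  refine le_antisymm ?_ (hA.dotProduct_mulVec_nonneg _)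
  have h0 : star v ⬝ᵥ (A *ᵥ v) = 0 := by rw [hv, dotProduct_zero]
  rw [← h0]
  simp only [dotProduct, mulVec, Finset.mul_sum, star_trivial, Pi.abs_apply]
  refine Finset.sum_le_sum fun s _ => Finset.sum_le_sum fun t _ => ?_
  by_cases hst : s = t
  · subst hst
    exact le_of_eq (by linear_combination A s s * abs_mul_abs_self (v s))
  · have h1 := hoff s t hst
    have h2 : v s * v t ≤ |v s| * |v t| := by rw [← abs_mul]; exact le_abs_self _
    nlinarith

/-- The step of the Perron-Frobenius argument: nonpositivity spreads along nonzero entries. -/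
theorem Matrix.PosSemidef.apply_nonpos_of_mulVec_eq_zero {A : Matrix n n ℝ} (hA : A.PosSemidef)
    (hoff : ∀ s t, s ≠ t → A s t ≤ 0) {v : n → ℝ} (hv : A *ᵥ v = 0) {s t : n} (hs : v s ≤ 0)
    (hAst : A s t < 0) : v t ≤ 0 := by
  -- `|v| + v` is twice the positive part of `v`, a nonnegative kernel vector vanishing at `s`. Row
  -- `s` is then a zero sum of nonpositive terms.
  have hw : A *ᵥ (|v| + v) = 0 := by
    rw [mulVec_add, hA.mulVec_abs_eq_zero hoff hv, hv, add_zero]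
  have hw0 : ∀ u, 0 ≤ (|v| + v) u := fun u => by
    have := neg_abs_le (v u)
    simp only [Pi.add_apply, Pi.abs_apply]; linarith
  have hws : (|v| + v) s = 0 := by simp [abs_of_nonpos hs]
  have h1 : ∑ u, A s u * (|v| + v) u = 0 := congrFun hw s
  have h2 : ∀ u ∈ Finset.univ, A s u * (|v| + v) u ≤ 0 := by
    intro u _
    by_cases hu : s = u
    · rw [← hu, hws, mul_zero]
    · exact mul_nonpos_of_nonpos_of_nonneg (hoff s u hu) (hw0 u)
  have h3 := (Finset.sum_eq_zero_iff_of_nonpos h2).mp h1 t (Finset.mem_univ t)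
  have h4 : (|v| + v) t = 0 := (mul_eq_zero.mp h3).resolve_left hAst.ne
  have h5 : |v t| + v t = 0 := h4
  linarith [abs_nonneg (v t)]

theorem Matrix.PosSemidef.map_re {K : Matrix n n ℂ} (hK : K.PosSemidef)
    (him : ∀ s t, (K s t).im = 0) : (K.map Complex.re).PosSemidef := by
  refine .of_dotProduct_mulVec_nonneg ?_ fun x => ?_
  · ext s t
    simpa using congrArg Complex.re (hK.isHermitian.apply s t)
  · have h := (Complex.le_def.mp (hK.dotProduct_mulVec_nonneg fun s => (x s : ℂ))).1
    simpa [dotProduct, mulVec, him] using h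

theorem Matrix.map_re_mulVec {K : Matrix n n ℂ} (him : ∀ s t, (K s t).im = 0) {ψ : n → ℂ}
    (hψ : K *ᵥ ψ = 0) : K.map Complex.re *ᵥ (fun s => (ψ s).re) = 0 := by
  funext s
  have := congrArg Complex.re (congrFun hψ s)
  simpa [mulVec, dotProduct, him] using this

theorem Matrix.PosSemidef.re_apply_nonpos {K : Matrix n n ℂ} (hK : K.PosSemidef)
    (him : ∀ s t, (K s t).im = 0) (hoff : ∀ s t, s ≠ t → (K s t).re ≤ 0) {ψ : n → ℂ}
    (hψ : K *ᵥ ψ = 0) {s t : n} (hs : (ψ s).re ≤ 0) (hKst : (K s t).re < 0) :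
    (ψ t).re ≤ 0 :=
  (hK.map_re him).apply_nonpos_of_mulVec_eq_zero (by simpa using hoff)
    (Matrix.map_re_mulVec him hψ) (s := s) hs (by simpa using hKst)

end Kernel

/-! ### The ground projection as a kernel projection. -/

section GroundSpace
open scoped ComplexOrder
open Matrix

theorem exists_hasEigenvalue_real {H : Op k} (hH : H.IsHermitian) :
    {E : ℝ | Module.End.HasEigenvalue (toEuclideanLin H) (E : ℂ)}.Nonempty := by
  refine ⟨hH.eigenvalues 0, Module.End.hasEigenvalue_of_hasEigenvector
    (x := hH.eigenvectorBasis 0) ⟨?_, hH.eigenvectorBasis.orthonormal.ne_zero 0⟩⟩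
  rw [Module.End.mem_eigenspace_iff]
  ext s
  have := congrFun (hH.mulVec_eigenvectorBasis 0) s
  simpa [toLpLin_apply] using this

theorem finite_hasEigenvalue_real (H : Op k) :
    {E : ℝ | Module.End.HasEigenvalue (toEuclideanLin H) (E : ℂ)}.Finite :=
  Set.Finite.preimage (Complex.ofReal_injective.injOn)
    (Module.End.finite_hasEigenvalue (toEuclideanLin H))

theorem hasEigenvalue_groundEnergy {H : Op k} (hH : H.IsHermitian) :
    Module.End.HasEigenvalue (toEuclideanLin H) (groundEnergy H : ℂ) :=
  (exists_hasEigenvalue_real hH).csInf_mem (finite_hasEigenvalue_real H)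

theorem posSemidef_sub_groundEnergy {H : Op k} (hH : H.IsHermitian) :
    (H - (groundEnergy H : ℂ) • 1).PosSemidef := by
  have hE : (((groundEnergy H : ℝ) : ℂ) • (1 : Op k)).IsHermitian := by
    rw [IsHermitian, conjTranspose_smul, conjTranspose_one]; simp
  have hK : (H - (groundEnergy H : ℂ) • 1).IsHermitian := hH.sub hE
  rw [hK.posSemidef_iff_eigenvalues_nonneg]
  intro j
  have h1 := hK.mulVec_eigenvectorBasis j
  have h2 : hK.eigenvalues j + groundEnergy H ∈
      -- An eigenvalue of the shifted matrix, moved back by the ground energy, is an eigenvalue of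
      -- `H`, hence at least the infimum.
      {E : ℝ | Module.End.HasEigenvalue (toEuclideanLin H) (E : ℂ)} := by
    refine Module.End.hasEigenvalue_of_hasEigenvector
      (x := hK.eigenvectorBasis j) ⟨?_, hK.eigenvectorBasis.orthonormal.ne_zero j⟩
    rw [Module.End.mem_eigenspace_iff]
    ext s
    have h3 := congrFun h1 s
    rw [sub_mulVec, smul_mulVec, one_mulVec] at h3
    simp only [Pi.sub_apply, Pi.smul_apply, Complex.real_smul, smul_eq_mul] at h3
    simp only [toLpLin_apply, PiLp.smul_apply, smul_eq_mul, Complex.ofReal_add]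
    linear_combination h3
  have h4 := csInf_le (finite_hasEigenvalue_real H).bddBelow h2
  change groundEnergy H ≤ _ at h4
  simpa using h4

theorem mem_groundSpace_iff {H : Op k} {v : EuclideanSpace ℂ (Config k)} :
    v ∈ groundSpace H ↔ (H - (groundEnergy H : ℂ) • 1) *ᵥ v.ofLp = 0 := by
  rw [groundSpace, Module.End.mem_eigenspace_iff, sub_mulVec, smul_mulVec, one_mulVec, sub_eq_zero,
    toLpLin_apply]
  constructor
  · intro h; exact congrArg WithLp.ofLp h
  · intro h; exact congrArg (WithLp.toLp 2) h

theorem groundProjection_mulVec (H : Op k) (v : EuclideanSpace ℂ (Config k)) :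
    groundProjection H *ᵥ v.ofLp = ((groundSpace H).starProjection v).ofLp := by
  have h : toEuclideanLin (groundProjection H) = ((groundSpace H).starProjection :
      EuclideanSpace ℂ (Config k) →ₗ[ℂ] EuclideanSpace ℂ (Config k)) :=
    LinearEquiv.apply_symm_apply _ _
  exact congrArg (fun f => (f v).ofLp) h

theorem isKernelProjection_groundProjection {H : Op k} (hH : H.IsHermitian) :
    IsKernelProjection (H - (groundEnergy H : ℂ) • 1) (groundProjection H) where
  posSemidef := posSemidef_sub_groundEnergy hH
  isHermitian := by
    rw [← isSymmetric_toEuclideanLin_iff]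
    have h : toEuclideanLin (groundProjection H) = ((groundSpace H).starProjection :
        EuclideanSpace ℂ (Config k) →ₗ[ℂ] EuclideanSpace ℂ (Config k)) :=
      LinearEquiv.apply_symm_apply _ _
    rw [h]
    exact (groundSpace H).starProjection_isSymmetric
  mul_self := by
    refine Matrix.ext_of_mulVec_single fun t => ?_
    rw [← mulVec_mulVec]
    have := groundProjection_mulVec H (WithLp.toLp 2 (Pi.single t 1))
    simp only at this
    rw [this, groundProjection_mulVec,
      Submodule.starProjection_eq_self_iff.mpr (Submodule.starProjection_apply_mem _ _)]
  ne_zero h := by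
    obtain ⟨v, hv, hv0⟩ := (hasEigenvalue_groundEnergy hH).exists_hasEigenvector
    have hv' : v ∈ groundSpace H := hv
    have h1 := groundProjection_mulVec H v
    rw [h, zero_mulVec, Submodule.starProjection_eq_self_iff.mpr hv'] at h1
    exact hv0 (congrArg (WithLp.toLp 2) h1.symm)
  mul_eq_zero := by
    refine Matrix.ext_of_mulVec_single fun t => ?_
    rw [← mulVec_mulVec, zero_mulVec]
    have := groundProjection_mulVec H (WithLp.toLp 2 (Pi.single t 1))
    simp only at this
    rw [this]
    exact mem_groundSpace_iff.mp (Submodule.starProjection_apply_mem _ _)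
  mul_eq_of_mul_eq_zero A hA := by
    refine Matrix.ext_of_mulVec_single fun t => ?_
    rw [← mulVec_mulVec]
    have h1 : WithLp.toLp 2 (A *ᵥ Pi.single t 1) ∈ groundSpace H := by
      rw [mem_groundSpace_iff]
      simp only
      rw [mulVec_mulVec, hA, zero_mulVec]
    have h2 := groundProjection_mulVec H (WithLp.toLp 2 (A *ᵥ Pi.single t 1))
    rwa [Submodule.starProjection_eq_self_iff.mpr h1] at h2

end GroundSpace

/-! ### Spreading of signs along gauge orbits. -/

section PenaltyKernel
open Matrix

variable {G' : Finset (Op k)}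

theorem IsPenaltySet.exists_xOp_or_zOp (hG : IsPenaltySet G') {g : Op k} (hg : g ∈ G') :
    (∃ v, g = xOp v) ∨ ∃ w, g = zOp w := by
  rcases hG.type_XZ g hg with ⟨S, rfl⟩ | ⟨S, rfl⟩
  · exact .inl ⟨_, pauliString_X S⟩
  · exact .inr ⟨_, pauliString_Z S⟩

theorem IsPenaltySet.isHermitian (hG : IsPenaltySet G') : (penaltyHamiltonian G').IsHermitian := by
  unfold penaltyHamiltonian
  rw [IsHermitian, conjTranspose_neg, conjTranspose_sum]
  congr 1
  refine Finset.sum_congr rfl fun g hg => ?_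
  rcases hG.exists_xOp_or_zOp hg with ⟨v, rfl⟩ | ⟨w, rfl⟩
  · exact xOp_isHermitian v
  · exact zOp_isHermitian w

theorem IsPenaltySet.exists_unit (hG : IsPenaltySet G') {g : Op k} (hg : g ∈ G') :
    ∃ u ∈ gaugeGroup k, (u : Op k) = g := by
  have h : ∃ u : (Op k)ˣ, (u : Op k) = g := by
    rcases hG.exists_xOp_or_zOp hg with ⟨v, rfl⟩ | ⟨w, rfl⟩
    · exact ⟨xUnit v, rfl⟩
    · exact ⟨zUnit w, rfl⟩
  obtain ⟨u, rfl⟩ := h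
  refine ⟨u, ?_, rfl⟩
  rw [← hG.generates]
  exact Subgroup.subset_closure hg

theorem IsPenaltySet.commute (hG : IsPenaltySet G') (E : ℂ) {C : Op k}
    (hC : ∀ g ∈ gaugeGenerators k, Commute g C) :
    Commute (penaltyHamiltonian G' - E • 1) C := by
  refine Commute.sub_left (Commute.neg_left (Commute.sum_left _ _ _ fun g hg => ?_))
    ((Commute.one_left C).smul_left E)
  obtain ⟨u, hu, rfl⟩ := hG.exists_unit hg
  exact commute_of_mem_gaugeGroup hC hu

theorem IsPenaltySet.im_eq_zero (hG : IsPenaltySet G') (E : ℝ) (s t : Config k) :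
    ((penaltyHamiltonian G' - (E : ℂ) • 1) s t).im = 0 := by
  have h1 : ∀ g ∈ G', (g s t).im = 0 := by
    intro g hg
    rcases hG.exists_xOp_or_zOp hg with ⟨v, rfl⟩ | ⟨w, rfl⟩
    · simp only [xOp, of_apply]; split_ifs <;> simp
    · simp only [zOp, diagonal_apply]
      split_ifs
      · rcases dotSign_eq_one_or w s with h | h <;> simp [h]
      · simp
  have h2 : (((E : ℂ) • (1 : Op k)) s t).im = 0 := by
    rw [Matrix.smul_apply, one_apply]; split_ifs <;> simp
  rw [Matrix.sub_apply, Complex.sub_im, h2, penaltyHamiltonian, Matrix.neg_apply, Matrix.sum_apply,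
    Complex.neg_im, Complex.im_sum, Finset.sum_eq_zero h1]
  simp

theorem IsPenaltySet.re_apply_of_ne (hG : IsPenaltySet G') {s t : Config k} (hst : s ≠ t)
    {g : Op k} (hg : g ∈ G') : 0 ≤ (g s t).re := by
  rcases hG.exists_xOp_or_zOp hg with ⟨v, rfl⟩ | ⟨w, rfl⟩
  · simp only [xOp, of_apply]; split_ifs <;> simp
  · simp [zOp, hst]

theorem penaltyHamiltonian_re_apply_of_ne (E : ℂ) {s t : Config k} (hst : s ≠ t) :
    ((penaltyHamiltonian G' - E • 1) s t).re = -∑ g ∈ G', (g s t).re := by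
  rw [Matrix.sub_apply, penaltyHamiltonian, Matrix.neg_apply, Matrix.sum_apply,
    Matrix.smul_apply, one_apply_ne hst]
  simp

theorem IsPenaltySet.re_nonpos_of_ne (hG : IsPenaltySet G') (E : ℂ) {s t : Config k}
    (hst : s ≠ t) : ((penaltyHamiltonian G' - E • 1) s t).re ≤ 0 := by
  rw [penaltyHamiltonian_re_apply_of_ne E hst, neg_nonpos]
  exact Finset.sum_nonneg fun g hg => hG.re_apply_of_ne hst hg

theorem IsPenaltySet.re_neg_of_mem (hG : IsPenaltySet G') (E : ℂ) {s v : Config k}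
    (hv : xOp v ∈ G') (hst : s ≠ s + v) :
    ((penaltyHamiltonian G' - E • 1) s (s + v)).re < 0 := by
  rw [penaltyHamiltonian_re_apply_of_ne E hst, neg_lt_zero]
  refine Finset.sum_pos' (fun g hg => hG.re_apply_of_ne hst hg) ⟨_, hv, ?_⟩
  simp [xOp, config_add_self, add_assoc]

/-- A set of configurations that is stable under the X-type elements of `G'` is stable under
all X-type gauge operators. -/
theorem IsPenaltySet.add_mem_of_forall (hG : IsPenaltySet G') {N : Set (Config k)}
    (hN : ∀ v, xOp v ∈ G' → ∀ s ∈ N, s + v ∈ N) {v : Config k} (hv : v ∈ xShifts k)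
    {s : Config k} (hs : s ∈ N) : s + v ∈ N := by
  -- An X-type gauge operator may arise as a word mixing both types. Tracking only the support of
  -- matrix entries, `p` says that `A` maps vectors supported on `N` to such vectors, so no normal
  -- form of words is needed.
  let p : Op k → Prop := fun A => ∀ t ∈ N, ∀ s ∉ N, A s t = 0
  have hp1 : p 1 := fun t ht s hs => one_apply_ne fun h => hs (h ▸ ht)
  have hpm : ∀ A B, p A → p B → p (A * B) := by
    intro A B hA hB t ht s hs
    rw [mul_apply]
    refine Finset.sum_eq_zero fun r _ => ?_
    by_cases hr : r ∈ N
    · rw [hA r hr s hs, zero_mul]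
    · rw [hB t ht r hr, mul_zero]
  have key : ∀ u ∈ groupGenerated (G' : Set (Op k)), p (u : Op k) ∧ p ((u⁻¹ : (Op k)ˣ) : Op k) := by
    intro u hu
    induction hu using Subgroup.closure_induction with
    | mem x hx =>
      have hx' : (x : Op k) ∈ G' := hx
      rcases hG.exists_xOp_or_zOp hx' with ⟨v, h⟩ | ⟨w, h⟩
      · have hpx : p (xOp v) := by
          intro t ht s hs
          simp only [xOp, of_apply]
          rw [if_neg]
          rintro rfl
          exact hs (hN v (h ▸ hx') t ht)
        obtain rfl : x = xUnit v := Units.ext h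
        exact ⟨hpx, hpx⟩
      · have hpx : p (zOp w) := fun t ht s hs => diagonal_apply_ne _ fun h => hs (h ▸ ht)
        obtain rfl : x = zUnit w := Units.ext h
        exact ⟨hpx, hpx⟩
    | one => exact ⟨hp1, by rw [inv_one]; exact hp1⟩
    | mul x y _ _ hx hy =>
      rw [_root_.mul_inv_rev, Units.val_mul, Units.val_mul]
      exact ⟨hpm _ _ hx.1 hy.1, hpm _ _ hy.2 hx.2⟩
    | inv x _ hx => rw [inv_inv]; exact hx.symm
  rw [hG.generates] at key
  by_contra hcon
  have h1 : xOp v (s + v) s = 0 := (key _ hv).1 s hs _ hcon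
  simp [xOp] at h1

section Spread
open scoped ComplexOrder

theorem IsPenaltySet.re_apply_add_nonpos (hG : IsPenaltySet G') {E : ℝ}
    (hK : (penaltyHamiltonian G' - (E : ℂ) • 1).PosSemidef) {A : Op k}
    (hA : (penaltyHamiltonian G' - (E : ℂ) • 1) * A = 0) {v : Config k} (hv : v ∈ xShifts k)
    {s t : Config k} (hs : (A s t).re ≤ 0) : (A (s + v) t).re ≤ 0 := by
  refine hG.add_mem_of_forall (N := {s | (A s t).re ≤ 0}) (fun v hv s hs => ?_) hv hs
  by_cases hst : s = s + v
  · rwa [← hst]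
  · refine hK.re_apply_nonpos (hG.im_eq_zero E) (fun s t h => hG.re_nonpos_of_ne E h)
      (ψ := fun r => A r t) ?_ hs (hG.re_neg_of_mem E hv hst)
    funext r
    exact congrFun (congrFun hA r) t

theorem IsPenaltySet.re_apply_add_eq_zero (hG : IsPenaltySet G') {E : ℝ}
    (hK : (penaltyHamiltonian G' - (E : ℂ) • 1).PosSemidef) {A : Op k}
    (hA : (penaltyHamiltonian G' - (E : ℂ) • 1) * A = 0) {v : Config k} (hv : v ∈ xShifts k)
    {s t : Config k} (hs : (A s t).re = 0) : (A (s + v) t).re = 0 := by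
  refine le_antisymm (hG.re_apply_add_nonpos hK hA hv hs.le) ?_
  have h := hG.re_apply_add_nonpos hK (A := -A) (by rw [Matrix.mul_neg, hA, neg_zero]) hv
    (s := s) (t := t) (by simp [hs])
  simpa using h

theorem eq_zero_of_re_of_I_smul {z : ℂ} (h1 : z.re = 0) (h2 : (Complex.I • z).re = 0) :
    z = 0 := Complex.ext h1 (by simpa using h2)

/-- Uniqueness in Perron–Frobenius: a gauge orbit supports at most one kernel direction. The
imaginary part is handled by applying the real case to `I • A`. -/
theorem IsPenaltySet.apply_add_eq_zero (hG : IsPenaltySet G') {E : ℝ}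
    (hK : (penaltyHamiltonian G' - (E : ℂ) • 1).PosSemidef) {A : Op k}
    (hA : (penaltyHamiltonian G' - (E : ℂ) • 1) * A = 0) {v : Config k} (hv : v ∈ xShifts k)
    {s t : Config k} (hs : A s t = 0) : A (s + v) t = 0 :=
  eq_zero_of_re_of_I_smul (hG.re_apply_add_eq_zero hK hA hv (by rw [hs]; rfl))
    (hG.re_apply_add_eq_zero hK (A := Complex.I • A)
      (by rw [Matrix.mul_smul, hA, smul_zero]) hv (s := s) (t := t) (by simp [hs]))

/-- Of two opposite real parts one is nonpositive; spreading makes the other nonpositive as well, so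
both vanish. -/
theorem IsPenaltySet.re_apply_eq_zero_of_neg (hG : IsPenaltySet G') {E : ℝ}
    (hK : (penaltyHamiltonian G' - (E : ℂ) • 1).PosSemidef) {A : Op k}
    (hA : (penaltyHamiltonian G' - (E : ℂ) • 1) * A = 0) {v : Config k} (hv : v ∈ xShifts k)
    {s t : Config k} (hs : A (s + v) t = -A s t) : (A s t).re = 0 := by
  have hs' : (A (s + v) t).re = -(A s t).re := by rw [hs, Complex.neg_re]
  have h2 := hG.re_apply_add_nonpos hK hA hv (s := s + v) (t := t)
  rw [add_assoc, config_add_self, add_zero] at h2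
  rcases le_total (A s t).re 0 with h | h
  · have h1 := hG.re_apply_add_nonpos hK hA hv h
    linarith
  · exact le_antisymm (h2 (by linarith)) h

/-- Every kernel vector that is odd under an X-type gauge operator vanishes. -/
theorem IsPenaltySet.apply_eq_zero_of_neg (hG : IsPenaltySet G') {E : ℝ}
    (hK : (penaltyHamiltonian G' - (E : ℂ) • 1).PosSemidef) {A : Op k}
    (hA : (penaltyHamiltonian G' - (E : ℂ) • 1) * A = 0) {v : Config k} (hv : v ∈ xShifts k)
    {s t : Config k} (hs : A (s + v) t = -A s t) : A s t = 0 :=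
  eq_zero_of_re_of_I_smul (hG.re_apply_eq_zero_of_neg hK hA hv hs)
    (hG.re_apply_eq_zero_of_neg hK (A := Complex.I • A)
      (by rw [Matrix.mul_smul, hA, smul_zero]) hv (s := s) (t := t) (by simp [hs]))

end Spread

/-- The difference `xOp 1 * P - P` lies in the kernel and is odd under the gauge shift `1`. -/
theorem IsPenaltySet.xOp_one_mul (hG : IsPenaltySet G') {E : ℝ} {P : Op k}
    (hP : IsKernelProjection (penaltyHamiltonian G' - (E : ℂ) • 1) P) : xOp 1 * P = P := by
  have hcomm := hG.commute (E : ℂ) (commute_xOp_generators (v := 1) (fun _ => rfl)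
    (fun _ _ => rfl))
  have hW : (penaltyHamiltonian G' - (E : ℂ) • 1) * (xOp 1 * P - P) = 0 := by
    rw [Matrix.mul_sub, ← Matrix.mul_assoc, hcomm.eq, Matrix.mul_assoc, hP.mul_eq_zero,
      Matrix.mul_zero, sub_zero]
  ext s t
  have h := hG.apply_eq_zero_of_neg hP.posSemidef hW one_mem_xShifts (s := s) (t := t) (by
    rw [Matrix.sub_apply, Matrix.sub_apply, xOp_mul_apply, xOp_mul_apply, add_assoc,
      config_add_self, add_zero, neg_sub])
  rw [Matrix.sub_apply] at h
  exact sub_eq_zero.mp h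

/-- The characters of the bare-logical Z operators and the Z stabilizer separate gauge orbits, so
`A` is block diagonal over orbits. -/
theorem add_mem_xShifts_of_commute {A : Op k}
    (hA : ∀ w : Config k, (∀ i, w (.B, i) = w (.R, i)) → (∀ i j, w (.L, i) = w (.L, j)) →
      Commute A (zOp w)) {s t : Config k} (hst : A s t ≠ 0) : s + t ∈ xShifts k := by
  refine mem_xShifts_of_dotSign fun w h1 h2 => ?_
  have h := congrFun (congrFun (hA w h1 h2).eq s) t
  rw [mul_zOp_apply, zOp_mul_apply, mul_comm] at h
  rw [dotSign_add_right, ← mul_right_cancel₀ hst h, dotSign_mul_self]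

/-- Bare-logical X shifts repair every mismatch between `B` and `R` bits; the remaining obstruction
to a gauge shift is the total parity. -/
theorem exists_decomposition_of_even {s : Config k} (hs : dotSign 1 s = 1) :
    ∃ v ∈ xShifts k, ∃ x : Config k, (∀ i, x (.B, i) = x (.L, i)) ∧
      (∀ i j, x (.R, i) = x (.R, j)) ∧ s = v + x := by
  let x : Config k := fun q => match q with
    | (.L, i) => s (.B, i) + s (.R, i)
    | (.B, i) => s (.B, i) + s (.R, i)
    | (.R, _) => 0
  refine ⟨s + x, mem_xShifts_of_eq (fun i => ?_) ?_, x, fun i => rfl, fun i j => rfl, ?_⟩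
  · change s (.B, i) + (s (.B, i) + s (.R, i)) = s (.R, i) + 0
    rw [← add_assoc, bit_add_self, zero_add, add_zero]
  · exact sum_eq_zero_of_dotSign_one hs
  · rw [add_assoc, config_add_self, add_zero]

end PenaltyKernel

/-! ### The gauge operators act as positive scalars. -/

section Expectation
open Matrix

variable {G' : Finset (Op k)}

theorem IsKernelProjection.apply_self {n : Type*} [Fintype n] {K P : Matrix n n ℂ}
    (h : IsKernelProjection K P) (t : n) :
    P t t = ((∑ r, Complex.normSq (P r t) : ℝ) : ℂ) := by
  conv_lhs => rw [← h.mul_self, mul_apply]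
  push_cast
  refine Finset.sum_congr rfl fun r _ => ?_
  rw [← h.isHermitian.apply t r, Complex.normSq_eq_conj_mul_self]; rfl

theorem IsKernelProjection.re_apply_self_nonneg {n : Type*} [Fintype n] {K P : Matrix n n ℂ}
    (h : IsKernelProjection K P) (t : n) : 0 ≤ (P t t).re := by
  rw [h.apply_self, Complex.ofReal_re]
  exact Finset.sum_nonneg fun r _ => Complex.normSq_nonneg _

theorem IsKernelProjection.apply_eq_zero {n : Type*} [Fintype n] {K P : Matrix n n ℂ}
    (h : IsKernelProjection K P) {t : n} (ht : P t t = 0) (s : n) : P s t = 0 := by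
  rw [h.apply_self, Complex.ofReal_eq_zero,
    Finset.sum_eq_zero_iff_of_nonneg fun r _ => Complex.normSq_nonneg _] at ht
  exact Complex.normSq_eq_zero.mp (ht s (Finset.mem_univ s))

theorem Matrix.IsHermitian.im_apply_self {n : Type*} {A : Matrix n n ℂ}
    (h : A.IsHermitian) (t : n) : (A t t).im = 0 :=
  Complex.conj_eq_iff_im.mp (h.apply t t)

/-- The Z stabilizer enters as the hypothesis `hZ` because it is obtained only later, by duality. -/
theorem IsPenaltySet.exists_mul_gaugeX_mul (hG : IsPenaltySet G') {E : ℝ} {P : Op k}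
    (hP : IsKernelProjection (penaltyHamiltonian G' - (E : ℂ) • 1) P) (hZ : zOp 1 * P = P)
    (i j : Fin (2 * k)) : ∃ α : ℝ, 0 < α ∧ P * gaugeX i j * P = (α : ℂ) • P := by
  rw [gaugeX, opX_mul_opX]
  set u : Config k := pairVec (.L, i) (.L, j) with hu
  have huX : u ∈ xShifts k := pairVec_LL_mem i j
  set Q : Op k := P * xOp u * P with hQ
  have hPz : ∀ w : Config k, (∀ i, w (.B, i) = w (.R, i)) → (∀ i j, w (.L, i) = w (.L, j)) →
      Commute P (zOp w) := fun w h1 h2 =>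
    hP.commute (hG.commute _ (commute_zOp_generators h1 h2)) (zOp_isHermitian w)
  have hQz : ∀ w : Config k, (∀ i, w (.B, i) = w (.R, i)) → (∀ i j, w (.L, i) = w (.L, j)) →
      Commute Q (zOp w) := fun w h1 h2 =>
    ((hPz w h1 h2).mul_left (commute_zOp_xOp (by
      rw [dotSign_comm, hu, dotSign_pairVec, h2 i j, bit_add_self, bitSign_zero_right])).symm
      ).mul_left (hPz w h1 h2)
  have hPx : ∀ x : Config k, (∀ i, x (.B, i) = x (.L, i)) → (∀ i j, x (.R, i) = x (.R, j)) →
      Commute P (xOp x) := fun x h1 h2 =>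
    hP.commute (hG.commute _ (commute_xOp_generators h1 h2)) (xOp_isHermitian x)
  have hQx : ∀ x : Config k, (∀ i, x (.B, i) = x (.L, i)) → (∀ i j, x (.R, i) = x (.R, j)) →
      Commute Q (xOp x) := fun x h1 h2 =>
    ((hPx x h1 h2).mul_left (commute_xOp_xOp _ _)).mul_left (hPx x h1 h2)
  have diag_shift : ∀ {A : Op k} {x t : Config k}, Commute A (xOp x) →
      A (t + x) (t + x) = A t t := by
    intro A x t h
    have := congrFun (congrFun h.eq (t + x)) t
    rwa [mul_xOp_apply, xOp_mul_apply, add_assoc, config_add_self, add_zero] at this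
  have hKQ : (penaltyHamiltonian G' - (E : ℂ) • 1) * Q = 0 := by
    rw [hQ, Matrix.mul_assoc, ← Matrix.mul_assoc _ P, hP.mul_eq_zero, Matrix.zero_mul]
  have hQherm : Q.IsHermitian := by
    rw [IsHermitian, hQ, conjTranspose_mul, conjTranspose_mul, hP.isHermitian.eq,
      (xOp_isHermitian u).eq, Matrix.mul_assoc]
  have hQzero : ∀ {t}, P t t = 0 → ∀ s, Q s t = 0 := by
    intro t ht s
    rw [hQ, mul_apply]
    exact Finset.sum_eq_zero fun r _ => by rw [hP.apply_eq_zero ht r, mul_zero]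
  -- each column of `Q` is proportional to the corresponding column of `P`
  have hcol : ∀ s t, P t t * Q s t = Q t t * P s t := by
    intro s t
    by_cases hst : s + t ∈ xShifts k
    -- This combination has columns in the kernel and vanishes at `(t, t)`, hence in column `t`
    -- along the orbit of `t`.
    · have h := hG.apply_add_eq_zero hP.posSemidef (A := P t t • Q - Q t t • P)
        (by rw [Matrix.mul_sub, Matrix.mul_smul, Matrix.mul_smul, hKQ, hP.mul_eq_zero, smul_zero,
          smul_zero, sub_zero]) hst (s := t) (t := t)
        (by simp only [Matrix.sub_apply, Matrix.smul_apply, smul_eq_mul]; ring)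
      have e : t + (s + t) = s := by rw [add_comm s, ← add_assoc, config_add_self, zero_add]
      rw [e] at h
      simpa [sub_eq_zero] using h
    · have h1 : P s t = 0 := by
        by_contra h; exact hst (add_mem_xShifts_of_commute hPz h)
      have h2 : Q s t = 0 := by
        by_contra h; exact hst (add_mem_xShifts_of_commute hQz h)
      rw [h1, h2, mul_zero, mul_zero]
  -- the factor of proportionality does not depend on the column
  have hrel : ∀ s t, s + t ∈ xShifts k → Q t t * P s s = Q s s * P t t := by
    intro s t hst
    by_cases h0 : P s t = 0
    · have e : s + (s + t) = t := by rw [← add_assoc, config_add_self, zero_add]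
      have h1 : P t t = 0 := by
        have := hG.apply_add_eq_zero hP.posSemidef hP.mul_eq_zero hst h0
        rwa [e] at this
      rw [h1, hQzero h1 t, mul_zero, zero_mul]
    · have h1 := hcol s t
      -- Hermiticity turns the relation for column `s` into a second relation between `Q s t` and `P
      -- s t`.
      have h2 := congrArg star (hcol t s)
      rw [star_mul', star_mul', hQherm.apply, hP.isHermitian.apply, hQherm.apply,
        hP.isHermitian.apply] at h2
      refine mul_right_cancel₀ h0 ?_
      linear_combination P t t * h2 - P s s * h1
  obtain ⟨t₀, ht₀⟩ : ∃ t, P t t ≠ 0 := by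
    by_contra! h
    exact hP.ne_zero (Matrix.ext fun s t => hP.apply_eq_zero (h t) s)
  have hodd : ∀ t, P t t ≠ 0 → dotSign 1 t = 1 := by
    intro t ht
    have := congrFun (congrFun hZ t) t
    rw [zOp_mul_apply] at this
    exact mul_right_cancel₀ ht (by rw [this, one_mul])
  have hconst : ∀ t, Q t t * P t₀ t₀ = Q t₀ t₀ * P t t := by
    intro t
    by_cases ht : P t t = 0
    · rw [ht, hQzero ht, zero_mul, mul_zero]
    obtain ⟨v, hv, x, hx1, hx2, hvx⟩ := exists_decomposition_of_even (s := t + t₀)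
      (by rw [dotSign_add_right, hodd t ht, hodd t₀ ht₀, one_mul])
    have e : t₀ = t + v + x := by
      rw [add_assoc, ← hvx, ← add_assoc, config_add_self, zero_add]
    -- The logical shift `x` leaves both diagonals unchanged, so only the gauge shift `v` within an
    -- orbit remains.
    rw [e, diag_shift (hPx x hx1 hx2), diag_shift (hQx x hx1 hx2)]
    refine hrel (t + v) t ?_
    rwa [add_comm t, add_assoc, config_add_self, add_zero]
  set c : ℂ := Q t₀ t₀ / P t₀ t₀ with hc
  have hQP : Q = c • P := by
    ext s t
    rw [Matrix.smul_apply, smul_eq_mul, hc]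
    by_cases ht : P t t = 0
    · rw [hQzero ht, hP.apply_eq_zero ht, mul_zero]
    · rw [div_mul_eq_mul_div, eq_div_iff ht₀]
      refine mul_left_cancel₀ ht ?_
      linear_combination P t₀ t₀ * hcol s t + P s t * hconst t
  have hre : ∀ t, (((P t t).re : ℝ) : ℂ) = P t t := fun t =>
    Complex.ext (by simp) (by simp [hP.isHermitian.im_apply_self])
  have hcr : ((c.re : ℝ) : ℂ) = c := by
    have h : c = (((Q t₀ t₀).re / (P t₀ t₀).re : ℝ) : ℂ) := by
      rw [hc]
      push_cast
      rw [hre]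
      congr 1
      exact Complex.ext (by simp) (by simp [hQherm.im_apply_self])
    rw [h, Complex.ofReal_re]
  refine ⟨c.re, ?_, by rw [hcr, hQP]⟩
  have hpos : ∀ t, P t t ≠ 0 → 0 < (P t (t + u)).re := by
    intro t ht
    have h1 : 0 < (P t t).re := lt_of_le_of_ne (hP.re_apply_self_nonneg t) fun h => ht (by
      rw [← hre t, ← h, Complex.ofReal_zero])
    have h2 : (P t (t + u)).re = (P (t + u) t).re := by
      rw [← hP.isHermitian.apply]; exact Complex.conj_re _
    rw [h2]
    by_contra! h
    -- Nonpositivity at `t + u` would spread back to `t`, against the positive diagonal entry.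
    have h3 := hG.re_apply_add_nonpos hP.posSemidef hP.mul_eq_zero huX h
    rw [add_assoc, config_add_self, add_zero] at h3
    linarith
  have hnonneg : ∀ t, 0 ≤ (P t (t + u)).re := by
    intro t
    by_cases ht : P t t = 0
    · rw [← hP.isHermitian.apply, hP.apply_eq_zero ht]; simp
    · exact (hpos t ht).le
  have htr : c * P.trace = ∑ t, P t (t + u) := by
    have h1 : Q.trace = (P * xOp u).trace := by
      rw [hQ, trace_mul_comm, ← Matrix.mul_assoc, hP.mul_self]
    rw [hQP, trace_smul, smul_eq_mul] at h1
    rw [h1]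
    exact Finset.sum_congr rfl fun t _ => mul_xOp_apply u P t t
  have htr' : c.re * ∑ t, (P t t).re = ∑ t, (P t (t + u)).re := by
    have h1 := congrArg Complex.re htr
    rw [← hcr, Complex.re_ofReal_mul, trace, Complex.re_sum, Complex.re_sum] at h1
    exact h1
  have h1 : 0 < ∑ t, (P t (t + u)).re :=
    Finset.sum_pos' (fun t _ => hnonneg t) ⟨t₀, Finset.mem_univ _, hpos t₀ ht₀⟩
  have h2 : 0 ≤ ∑ t, (P t t).re := Finset.sum_nonneg fun t _ => hP.re_apply_self_nonneg t
  rw [← htr'] at h1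
  exact pos_of_mul_pos_left h1 h2

end Expectation

/-! ### Hadamard duality between X and Z. -/

section Duality
open Matrix
open scoped ComplexOrder

/-- The exchange of `L` and `R`. -/
def swapLR : Site → Site
  | .L => .R
  | .B => .B
  | .R => .L

/-- The exchange of the qubits `L_i` and `R_i`. -/
def swapQubit : Equiv.Perm (Qubit k) :=
  Function.Involutive.toPerm (fun q => (swapLR q.1, q.2)) fun ⟨s, _⟩ => by cases s <;> rfl

theorem swapQubit_swapQubit (q : Qubit k) : swapQubit (swapQubit q) = q := by
  obtain ⟨s, i⟩ := q
  cases s <;> rfl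

/-- The action of `swapQubit` on configurations. -/
def swapConfig (s : Config k) : Config k := fun q => s (swapQubit q)

theorem swapConfig_swapConfig (s : Config k) : swapConfig (swapConfig s) = s :=
  funext fun q => congrArg s (swapQubit_swapQubit q)

theorem swapConfig_add (s t : Config k) : swapConfig (s + t) = swapConfig s + swapConfig t := rfl

theorem swapConfig_one : swapConfig (1 : Config k) = 1 := rfl

theorem swapConfig_pairVec (q r : Qubit k) :
    swapConfig (pairVec q r) = pairVec (swapQubit q) (swapQubit r) := by
  have h : ∀ p q : Qubit k, swapQubit p = q ↔ p = swapQubit q := fun p q =>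
    ⟨fun h => by rw [← h, swapQubit_swapQubit], fun h => by rw [h, swapQubit_swapQubit]⟩
  funext p
  simp only [swapConfig, pairVec_apply, h]

theorem dotSign_swapConfig (s t : Config k) :
    dotSign s (swapConfig t) = dotSign (swapConfig s) t := by
  unfold dotSign
  rw [← Equiv.prod_comp swapQubit]
  simp only [swapConfig, swapQubit_swapQubit]

theorem sum_dotSign (w : Config k) :
    ∑ s, dotSign w s = if w = 0 then (Fintype.card (Config k) : ℂ) else 0 := by
  split_ifs with h
  · simp [h]
  · obtain ⟨q, hq⟩ := Function.ne_iff.mp h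
    have hq1 : w q = 1 := by
      have : ∀ a : Fin 2, a ≠ 0 → a = 1 := by decide
      exact this _ hq
    -- Translating by a bit on which the character is `-1` shows that the sum equals its negative.
    have h1 : ∑ s, dotSign w s = ∑ s : Config k, dotSign w (s + Pi.single q 1) :=
      (Equiv.sum_comp (Equiv.addRight (Pi.single q 1 : Config k)) (dotSign w)).symm
    have h2 : dotSign w (Pi.single q 1) = -1 := by
      rw [dotSign_comm, dotSign_single, hq1]; simp [bitSign]
    simp only [dotSign_add_right, h2, mul_neg, mul_one, Finset.sum_neg_distrib] at h1
    exact self_eq_neg.mp h1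

/-- The Hadamard transform on all qubits, followed by the exchange of `L_i` and `R_i`. -/
def hadamard (k : ℕ) : Op k :=
  (((√(Fintype.card (Config k)))⁻¹ : ℝ) : ℂ) • Matrix.of fun s t => dotSign s (swapConfig t)

theorem hadamard_apply (s t : Config k) : hadamard k s t =
    (((√(Fintype.card (Config k)))⁻¹ : ℝ) : ℂ) * dotSign s (swapConfig t) := rfl

theorem hadamard_isHermitian : (hadamard k).IsHermitian := by
  ext s t
  rw [conjTranspose_apply, hadamard_apply, hadamard_apply, star_mul', star_dotSign,
    dotSign_swapConfig, dotSign_comm (swapConfig t)]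
  congr 1
  exact Complex.conj_ofReal _

theorem hadamard_mul_self : hadamard k * hadamard k = 1 := by
  have hN : ((√(Fintype.card (Config k)))⁻¹ * (√(Fintype.card (Config k)))⁻¹ *
      Fintype.card (Config k) : ℝ) = 1 := by
    have h : (0 : ℝ) < Fintype.card (Config k) := by exact_mod_cast Fintype.card_pos
    rw [← mul_inv, Real.mul_self_sqrt h.le, inv_mul_cancel₀ h.ne']
  ext s t
  have h1 : (hadamard k * hadamard k) s t = (((√(Fintype.card (Config k)))⁻¹ : ℝ) : ℂ) *
      (((√(Fintype.card (Config k)))⁻¹ : ℝ) : ℂ) *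
        ∑ u, dotSign (swapConfig s + swapConfig t) u := by
    rw [mul_apply, Finset.mul_sum]
    refine Finset.sum_congr rfl fun u _ => ?_
    rw [hadamard_apply, hadamard_apply, dotSign_add_left, dotSign_swapConfig s,
      dotSign_comm u]
    ring
  have h2 : swapConfig s + swapConfig t = 0 ↔ s = t := by
    constructor
    · intro h
      rw [← swapConfig_add] at h
      have h3 : s + t = 0 := by rw [← swapConfig_swapConfig (s + t), h]; rfl
      rw [← zero_add t, ← h3, add_assoc, config_add_self, add_zero]
    · rintro rfl; exact config_add_self _
  rw [h1, sum_dotSign, one_apply]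
  simp only [h2]
  split_ifs
  · exact_mod_cast hN
  · rw [mul_zero]

/-- Conjugation by the Hadamard transform with exchange of `L` and `R`. It exchanges X-type and
Z-type operators and preserves the gauge group. -/
def dual (A : Op k) : Op k := hadamard k * A * hadamard k

theorem dual_mul (A B : Op k) : dual (A * B) = dual A * dual B := by
  have h : dual A * dual B = hadamard k * A * (hadamard k * hadamard k) * B * hadamard k := by
    simp only [dual, Matrix.mul_assoc]
  rw [h, hadamard_mul_self, Matrix.mul_one, dual]
  simp only [Matrix.mul_assoc]

theorem dual_one : dual (1 : Op k) = 1 := by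
  rw [dual, Matrix.mul_one, hadamard_mul_self]

theorem dual_zero : dual (0 : Op k) = 0 := by
  rw [dual, Matrix.mul_zero, Matrix.zero_mul]

theorem dual_dual (A : Op k) : dual (dual A) = A := by
  have h : dual (dual A) = hadamard k * hadamard k * A * (hadamard k * hadamard k) := by
    simp only [dual, Matrix.mul_assoc]
  rw [h, hadamard_mul_self, Matrix.mul_one, Matrix.one_mul]

theorem dual_injective : Function.Injective (dual : Op k → Op k) :=
  Function.LeftInverse.injective dual_dual

theorem dual_smul (c : ℂ) (A : Op k) : dual (c • A) = c • dual A := by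
  rw [dual, dual, Matrix.mul_smul, Matrix.smul_mul]

theorem dual_sub (A B : Op k) : dual (A - B) = dual A - dual B := by
  rw [dual, dual, dual, Matrix.mul_sub, Matrix.sub_mul]

theorem dual_neg (A : Op k) : dual (-A) = -dual A := by
  rw [dual, dual, Matrix.mul_neg, Matrix.neg_mul]

theorem dual_sum {ι : Type*} (S : Finset ι) (f : ι → Op k) :
    dual (∑ i ∈ S, f i) = ∑ i ∈ S, dual (f i) := by
  simp only [dual, Matrix.mul_sum, Matrix.sum_mul]

theorem dual_xOp (v : Config k) : dual (xOp v) = zOp (swapConfig v) := by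
  have h : hadamard k * xOp v = zOp (swapConfig v) * hadamard k := by
    ext s t
    rw [mul_xOp_apply, zOp_mul_apply, hadamard_apply, hadamard_apply, swapConfig_add,
      dotSign_add_right, dotSign_comm s (swapConfig v)]
    ring
  rw [dual, h, Matrix.mul_assoc, hadamard_mul_self, Matrix.mul_one]

theorem dual_zOp (w : Config k) : dual (zOp w) = xOp (swapConfig w) := by
  rw [← dual_dual (xOp _), dual_xOp, swapConfig_swapConfig]

theorem dual_gaugeX (i j : Fin (2 * k)) : dual (gaugeX i j) = gaugeZ i j := by
  rw [gaugeX, gaugeZ, opX_mul_opX, opZ_mul_opZ, dual_xOp, swapConfig_pairVec]; rfl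

theorem dual_mem_gaugeGenerators : ∀ g ∈ gaugeGenerators k, dual g ∈ gaugeGenerators k := by
  refine forall_generators (fun i => ?_) (fun i j h => ?_) (fun i => ?_) (fun i j h => ?_)
  · rw [dual_xOp, swapConfig_pairVec]
    exact .inr (.inr (.inl ⟨i, (opZ_mul_opZ ..).symm⟩))
  · rw [dual_xOp, swapConfig_pairVec]
    exact .inr (.inr (.inr ⟨i, j, h, (opZ_mul_opZ ..).symm⟩))
  · rw [dual_zOp, swapConfig_pairVec]
    exact .inl ⟨i, (opX_mul_opX ..).symm⟩
  · rw [dual_zOp, swapConfig_pairVec]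
    exact .inr (.inl ⟨i, j, h, (opX_mul_opX ..).symm⟩)

theorem dual_image_gaugeGenerators : dual '' gaugeGenerators k = gaugeGenerators k := by
  refine Set.Subset.antisymm ?_ fun g hg => ⟨dual g, dual_mem_gaugeGenerators g hg, dual_dual g⟩
  rintro _ ⟨g, hg, rfl⟩
  exact dual_mem_gaugeGenerators g hg

/-- `dual` on the group of invertible operators. -/
def dualUnits : (Op k)ˣ ≃* (Op k)ˣ :=
  MulAut.conj ⟨hadamard k, hadamard k, hadamard_mul_self, hadamard_mul_self⟩

theorem val_dualUnits (u : (Op k)ˣ) : (dualUnits u : Op k) = dual (u : Op k) := rfl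

theorem groupGenerated_dual_image (S : Set (Op k)) :
    groupGenerated (dual '' S) = (groupGenerated S).map dualUnits.toMonoidHom := by
  rw [groupGenerated, groupGenerated, MonoidHom.map_closure]
  congr 1
  ext u
  constructor
  · rintro ⟨g, hg, hgu⟩
    refine ⟨dualUnits u, ?_, Units.ext ?_⟩
    · change dual (u : Op k) ∈ S
      rwa [← hgu, dual_dual]
    · exact dual_dual (u : Op k)
  · rintro ⟨w, hw, rfl⟩
    exact ⟨w, hw, rfl⟩

theorem gaugeGroup_map_dualUnits :
    (gaugeGroup k).map dualUnits.toMonoidHom = gaugeGroup k := by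
  rw [gaugeGroup, ← groupGenerated_dual_image, dual_image_gaugeGenerators]

open Classical in
theorem IsPenaltySet.image_dual {G' : Finset (Op k)} (hG : IsPenaltySet G') :
    IsPenaltySet (G'.image dual) where
  type_XZ g hg := by
    obtain ⟨h, hh, rfl⟩ := Finset.mem_image.mp hg
    rcases hG.exists_xOp_or_zOp hh with ⟨v, rfl⟩ | ⟨w, rfl⟩
    · exact .inr ⟨_, (dual_xOp v).trans (zOp_eq_pauliString _)⟩
    · exact .inl ⟨_, (dual_zOp w).trans (xOp_eq_pauliString _)⟩
  generates := by
    rw [Finset.coe_image, groupGenerated_dual_image, hG.generates, gaugeGroup_map_dualUnits]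

open Classical in
theorem penaltyHamiltonian_image_dual (G' : Finset (Op k)) :
    penaltyHamiltonian (G'.image dual) = dual (penaltyHamiltonian G') := by
  rw [penaltyHamiltonian, penaltyHamiltonian, dual_neg, dual_sum,
    Finset.sum_image dual_injective.injOn]

/-- Only the kernel properties are transported, so the ground energy of the dual Hamiltonian need
not be identified. -/
theorem IsKernelProjection.dual {K P : Op k} (h : IsKernelProjection K P) :
    IsKernelProjection (dual K) (dual P) where
  posSemidef := by
    have := h.posSemidef.conjTranspose_mul_mul_same (hadamard k)
    rwa [hadamard_isHermitian.eq] at this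
  isHermitian := by
    rw [IsHermitian, _root_.dual, conjTranspose_mul, conjTranspose_mul, h.isHermitian.eq,
      hadamard_isHermitian.eq, Matrix.mul_assoc]
  mul_self := by rw [← dual_mul, h.mul_self]
  ne_zero h0 := h.ne_zero (dual_injective (h0.trans dual_zero.symm))
  mul_eq_zero := by rw [← dual_mul, h.mul_eq_zero, dual_zero]
  mul_eq_of_mul_eq_zero A hA := by
    have h1 : K * _root_.dual A = 0 := dual_injective (by rw [dual_mul, dual_dual, hA, dual_zero])
    rw [← dual_dual A, ← dual_mul, h.mul_eq_of_mul_eq_zero _ h1]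

open Classical in
theorem IsKernelProjection.dual_penalty {G' : Finset (Op k)} {E : ℂ} {P : Op k}
    (hP : IsKernelProjection (penaltyHamiltonian G' - E • 1) P) :
    IsKernelProjection (penaltyHamiltonian (G'.image _root_.dual) - E • 1) (_root_.dual P) := by
  have h := hP.dual
  rwa [dual_sub, dual_smul, dual_one, ← penaltyHamiltonian_image_dual] at h

open Classical in
theorem IsPenaltySet.zOp_one_mul {G' : Finset (Op k)} (hG : IsPenaltySet G') {E : ℝ} {P : Op k}
    (hP : IsKernelProjection (penaltyHamiltonian G' - (E : ℂ) • 1) P) : zOp 1 * P = P := by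
  have h := hG.image_dual.xOp_one_mul hP.dual_penalty
  refine dual_injective ?_
  rwa [dual_mul, dual_zOp, swapConfig_one]

open Classical in
theorem IsPenaltySet.exists_mul_gaugeZ_mul {G' : Finset (Op k)} (hG : IsPenaltySet G') {E : ℝ}
    {P : Op k} (hP : IsKernelProjection (penaltyHamiltonian G' - (E : ℂ) • 1) P)
    (i j : Fin (2 * k)) : ∃ α : ℝ, 0 < α ∧ P * gaugeZ i j * P = (α : ℂ) • P := by
  obtain ⟨α, hα, h⟩ := hG.image_dual.exists_mul_gaugeX_mul hP.dual_penalty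
    (hG.image_dual.zOp_one_mul hP.dual_penalty) i j
  refine ⟨α, hα, dual_injective ?_⟩
  rw [dual_mul, dual_mul, dual_smul, ← dual_gaugeX, dual_dual, h]

end Duality

/-! ### Compensated Hamiltonian and suppression of the bath coupling. -/

section Compensation
open Matrix
open scoped ComplexOrder

theorem groundExpectation_eq {H g : Op k} {α : ℝ}
    (hPP : groundProjection H * groundProjection H = groundProjection H)
    (htr : (groundProjection H).trace ≠ 0)
    (h : groundProjection H * g * groundProjection H = (α : ℂ) • groundProjection H) :
    groundExpectation H g = α := by
  have h1 : (groundProjection H * g).trace = α * (groundProjection H).trace := by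
    have := congrArg trace h
    rwa [trace_smul, smul_eq_mul, trace_mul_comm, ← Matrix.mul_assoc, hPP] at this
  rw [groundExpectation, h1, mul_div_assoc, div_self htr, mul_one, Complex.ofReal_re]

theorem IsKernelProjection.trace_ne_zero {n : Type*} [Fintype n] {K P : Matrix n n ℂ}
    (h : IsKernelProjection K P) : P.trace ≠ 0 := by
  intro h0
  refine h.ne_zero ?_
  rw [← trace_conjTranspose_mul_self_eq_zero_iff, h.isHermitian.eq, h.mul_self, h0]

theorem commute_logicalX (i : Fin (2 * k)) : ∀ g ∈ gaugeGenerators k, Commute g (logicalX i) := by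
  rw [logicalX, opX_mul_opX]
  exact commute_xOp_generators (fun j => by simp [pairVec_apply]) fun j l => by
    simp [pairVec_apply]

theorem commute_logicalZ (i : Fin (2 * k)) : ∀ g ∈ gaugeGenerators k, Commute g (logicalZ i) := by
  rw [logicalZ, opZ_mul_opZ]
  exact commute_zOp_generators (fun j => by simp [pairVec_apply]) fun j l => by
    simp [pairVec_apply]

theorem pairVec_add_add (p q p' q' : Qubit k) :
    pairVec p q + pairVec p' q' + pairVec q q' = pairVec p p' := by
  rw [add_right_comm, pairVec_add, pairVec_comm p' q', pairVec_add]

theorem opX_B_mul_opX_B (i j : Fin (2 * k)) :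
    (opX .B i * opX .B j : Op k) = logicalX i * logicalX j * gaugeX i j := by
  simp only [logicalX, gaugeX, opX_mul_opX, xOp_mul, pairVec_add_add]

theorem opZ_B_mul_opZ_B (i j : Fin (2 * k)) :
    (opZ .B i * opZ .B j : Op k) = logicalZ i * logicalZ j * gaugeZ i j := by
  simp only [logicalZ, gaugeZ, opZ_mul_opZ, zOp_mul, pairVec_add_add]

theorem gaugeX_mem (i j : Fin (2 * k)) : ∃ u ∈ gaugeGroup k, (u : Op k) = gaugeX i j :=
  ⟨_, pairVec_LL_mem i j, by rw [gaugeX, opX_mul_opX]; rfl⟩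

theorem gaugeZ_mem (i j : Fin (2 * k)) : ∃ u ∈ gaugeGroup k, (u : Op k) = gaugeZ i j := by
  obtain ⟨u, hu, h⟩ := gaugeX_mem i j
  refine ⟨dualUnits u, ?_, by rw [val_dualUnits, h, dual_gaugeX]⟩
  rw [← gaugeGroup_map_dualUnits]
  exact ⟨u, hu, rfl⟩

theorem commute_encodedHamiltonian {P : Op k} (hX : ∀ i, Commute P (logicalX i))
    (hZ : ∀ i, Commute P (logicalZ i)) (a b : Fin (2 * k) → ℝ)
    (c d : Fin (2 * k) → Fin (2 * k) → ℝ) :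
    Commute P (encodedHamiltonian a b c d) := by
  unfold encodedHamiltonian
  refine Commute.add_right (Commute.add_right (Commute.add_right ?_ ?_) ?_) ?_
  · exact Commute.sum_right _ _ _ fun i _ => (hX i).smul_right _
  · exact Commute.sum_right _ _ _ fun i _ => (hZ i).smul_right _
  · exact Commute.sum_right _ _ _ fun i _ => Commute.sum_right _ _ _ fun j _ =>
      ((hX i).mul_right (hX j)).smul_right _
  · exact Commute.sum_right _ _ _ fun i _ => Commute.sum_right _ _ _ fun j _ =>
      ((hZ i).mul_right (hZ j)).smul_right _

/-- Moving `A` out of the projected product leaves `P * g * P`, whose scalar `α` cancels the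
division in the coefficient. -/
theorem smul_mul_compensation {P A B g : Op k} {α : ℝ} (c : ℝ) (hα : α ≠ 0) (hPP : P * P = P)
    (hA : Commute P A) (hg : P * g * P = (α : ℂ) • P) (hB : B = A * g) :
    P * (((c / α : ℝ) : ℂ) • B) * P = P * ((c : ℂ) • A) * P := by
  have h1 : P * (A * g) * P = (α : ℂ) • (P * A * P) := by
    rw [← Matrix.mul_assoc, hA.eq, Matrix.mul_assoc A, Matrix.mul_assoc A, hg, Matrix.mul_smul,
      Matrix.mul_assoc A, hPP]
  rw [hB, Matrix.mul_smul, Matrix.smul_mul, h1, smul_smul, Matrix.mul_smul, Matrix.smul_mul]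
  congr 1
  rw [← Complex.ofReal_mul, div_mul_cancel₀ c hα]

theorem mul_physicalHamiltonian_mul {P : Op k} (hPP : P * P = P)
    (hX : ∀ i, Commute P (logicalX i)) (hZ : ∀ i, Commute P (logicalZ i))
    {αx αz : Fin (2 * k) → Fin (2 * k) → ℝ}
    (hαx : ∀ i j, 0 < αx i j ∧ P * gaugeX i j * P = (αx i j : ℂ) • P)
    (hαz : ∀ i j, 0 < αz i j ∧ P * gaugeZ i j * P = (αz i j : ℂ) • P)
    (a b : Fin (2 * k) → ℝ) (c d : Fin (2 * k) → Fin (2 * k) → ℝ) :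
    P * physicalHamiltonian a b (fun i j => c i j / αx i j) (fun i j => d i j / αz i j) * P =
      P * encodedHamiltonian a b c d * P := by
  have hLB : ∀ i, (opX .L i * opX .B i : Op k) = logicalX i := fun i => by
    rw [logicalX, opX_mul_opX, opX_mul_opX, pairVec_comm]
  simp only [physicalHamiltonian, encodedHamiltonian, hLB, Matrix.mul_add, Matrix.add_mul,
    Matrix.mul_sum, Matrix.sum_mul]
  refine congrArg₂ (· + ·) (congrArg₂ (· + ·) rfl ?_) ?_
  · refine Finset.sum_congr rfl fun i _ => Finset.sum_congr rfl fun j _ => ?_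
    exact smul_mul_compensation _ (hαx i j).1.ne' hPP ((hX i).mul_right (hX j)) (hαx i j).2
      (opX_B_mul_opX_B i j)
  · refine Finset.sum_congr rfl fun i _ => Finset.sum_congr rfl fun j _ => ?_
    exact smul_mul_compensation _ (hαz i j).1.ne' hPP ((hZ i).mul_right (hZ j)) (hαz i j).2
      (opZ_B_mul_opZ_B i j)

theorem pauliAt_apply_eq_zero {p : Pauli} {q : Qubit k} {s t : Config k}
    (h : ∃ r ≠ q, s r ≠ t r) : pauliAt p q s t = 0 := by
  obtain ⟨r, hr, hst⟩ := h
  simp only [pauliAt, pauliString, tensorOp, of_apply]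
  exact Finset.prod_eq_zero (Finset.mem_univ r) (by simp [hr, hst])

theorem pauliAt_apply_eq_zero_of_eq {p : Pauli} (hp : p ≠ .Z) {q : Qubit k} {s t : Config k}
    (h : s q = t q) : pauliAt p q s t = 0 := by
  simp only [pauliAt, pauliString, tensorOp, of_apply]
  refine Finset.prod_eq_zero (Finset.mem_univ q) ?_
  simp only [Finset.mem_singleton, if_true, h]
  generalize t q = a
  cases p <;> fin_cases a <;> simp_all [Pauli.mat]

/-- X and Y flip exactly one bit, hence reverse the total parity measured by `zOp 1`. -/
theorem zOp_one_mul_pauliAt {p : Pauli} (hp : p ≠ .Z) (q : Qubit k) :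
    zOp 1 * pauliAt p q = -(pauliAt p q * zOp 1) := by
  ext s t
  rw [zOp_mul_apply, neg_apply, mul_zOp_apply]
  by_cases h : pauliAt p q s t = 0
  · rw [h]; simp
  have hs : s = t + Pi.single q 1 := by
    funext r
    by_cases hr : r = q
    · subst hr
      have hne : s r ≠ t r := fun h' => h (pauliAt_apply_eq_zero_of_eq hp h')
      rw [Pi.add_apply, Pi.single_eq_same]
      revert hne
      generalize s r = a
      generalize t r = b
      revert a b; decide
    · rw [Pi.add_apply, Pi.single_eq_of_ne hr, add_zero]
      by_contra hne
      exact h (pauliAt_apply_eq_zero ⟨r, hr, hne⟩)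
  have h1 : dotSign 1 (Pi.single q 1 : Config k) = -1 := by
    rw [dotSign_comm, dotSign_single]; simp [bitSign]
  have h2 : dotSign 1 s = -dotSign 1 t := by rw [hs, dotSign_add_right, h1, mul_neg, mul_one]
  rw [h2]; ring

theorem xOp_one_mul_pauliAt_Z (q : Qubit k) :
    xOp 1 * pauliAt .Z q = -(pauliAt .Z q * xOp 1) := by
  obtain ⟨s, i⟩ := q
  have h : dotSign (Pi.single (s, i) 1 : Config k) 1 = -1 := by
    rw [dotSign_single]; simp [bitSign]
  change xOp 1 * opZ s i = -(opZ s i * xOp 1)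
  rw [opZ_eq, zOp_mul_xOp, h, neg_one_smul, neg_neg]

/-- An operator that anticommutes with a stabilizer has vanishing projection on the code space. -/
theorem mul_mul_eq_zero_of_anticommute {P S A : Op k} (hP : P.IsHermitian) (hS : S.IsHermitian)
    (hSP : S * P = P) (h : S * A = -(A * S)) : P * A * P = 0 := by
  have hPS : P * S = P := by
    have := congrArg conjTranspose hSP
    rwa [conjTranspose_mul, hP.eq, hS.eq] at this
  have h1 : P * A * P = -(P * A * P) := by
    calc P * A * P = P * (S * A) * P := by rw [← Matrix.mul_assoc, hPS]
      _ = -(P * A * (S * P)) := by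
        rw [h]; simp only [Matrix.mul_neg, Matrix.neg_mul, Matrix.mul_assoc]
      _ = -(P * A * P) := by rw [hSP]
  ext s t
  exact self_eq_neg.mp (congrFun (congrFun h1 s) t)

theorem systemBath_mul_coupling_mul {V : Type*} [AddCommGroup V] [Module ℂ V] {P : Op k}
    (hP : ∀ p q, P * pauliAt p q * P = 0) (B : Qubit k → Pauli → Module.End ℂ V) :
    systemBath P (1 : Module.End ℂ V) * systemBathCoupling B *
      systemBath P (1 : Module.End ℂ V) = 0 := by
  simp only [systemBathCoupling, Finset.mul_sum, Finset.sum_mul]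
  refine Finset.sum_eq_zero fun q _ => Finset.sum_eq_zero fun p _ => ?_
  rw [systemBath, systemBath, ← TensorProduct.map_mul, ← TensorProduct.map_mul,
    Module.End.mul_eq_comp (toLin' P), ← toLin'_mul, Module.End.mul_eq_comp (toLin' _) (toLin' P),
    ← toLin'_mul, hP, map_zero, TensorProduct.map_zero_left]

end Compensation

end

theorem mainTheorem4 (k : ℕ) (G' : Finset (Op k)) (hG' : IsPenaltySet G') :
    let P : Op k := groundProjection (penaltyHamiltonian G')
    let αx : Fin (2 * k) → Fin (2 * k) → ℝ :=
      fun i j => groundExpectation (penaltyHamiltonian G') (gaugeX i j)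
    let αz : Fin (2 * k) → Fin (2 * k) → ℝ :=
      fun i j => groundExpectation (penaltyHamiltonian G') (gaugeZ i j)
    -- the two-local couplings are products of bare-logical operators and gauge operators
    (∀ i j : Fin (2 * k),
      (∃ u ∈ gaugeGroup k, (u : Op k) = gaugeX i j) ∧
      (∃ u ∈ gaugeGroup k, (u : Op k) = gaugeZ i j) ∧
      (opX .B i * opX .B j : Op k) = logicalX i * logicalX j * gaugeX i j ∧
      (opZ .B i * opZ .B j : Op k) = logicalZ i * logicalZ j * gaugeZ i j) ∧
    -- the gauge operators act on the ground space as positive scalars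
    (∀ i j : Fin (2 * k),
      0 < αx i j ∧ P * gaugeX i j * P = (αx i j : ℂ) • P ∧
      0 < αz i j ∧ P * gaugeZ i j * P = (αz i j : ℂ) • P) ∧
    -- the rescaled two-local Hamiltonian reproduces the encoded Hamiltonian at all times
    (∀ (a b : ℝ → Fin (2 * k) → ℝ) (c d : ℝ → Fin (2 * k) → Fin (2 * k) → ℝ) (t : ℝ),
      P * physicalHamiltonian (a t) (b t) (fun i j => c t i j / αx i j)
          (fun i j => d t i j / αz i j) * P =
        P * encodedHamiltonian (a t) (b t) (c t) (d t) * P ∧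
      P * encodedHamiltonian (a t) (b t) (c t) (d t) * P =
        P * encodedHamiltonian (a t) (b t) (c t) (d t)) ∧
    -- one-local system-bath couplings vanish on the ground space
    (∀ (V : Type*) [AddCommGroup V] [Module ℂ V] (B : Qubit k → Pauli → Module.End ℂ V),
      systemBath P (1 : Module.End ℂ V) * systemBathCoupling B *
        systemBath P (1 : Module.End ℂ V) = 0) := by
  intro P αx αz
  have hP : IsKernelProjection
      (penaltyHamiltonian G' - (groundEnergy (penaltyHamiltonian G') : ℂ) • 1) P :=
    isKernelProjection_groundProjection hG'.isHermitian
  have hZP := hG'.zOp_one_mul hP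
  have hXP := hG'.xOp_one_mul hP
  have hαx : ∀ i j, 0 < αx i j ∧ P * gaugeX i j * P = (αx i j : ℂ) • P := by
    intro i j
    obtain ⟨α, h0, h⟩ := hG'.exists_mul_gaugeX_mul hP hZP i j
    have e : αx i j = α := groundExpectation_eq hP.mul_self hP.trace_ne_zero h
    rw [e]; exact ⟨h0, h⟩
  have hαz : ∀ i j, 0 < αz i j ∧ P * gaugeZ i j * P = (αz i j : ℂ) • P := by
    intro i j
    obtain ⟨α, h0, h⟩ := hG'.exists_mul_gaugeZ_mul hP i j
    have e : αz i j = α := groundExpectation_eq hP.mul_self hP.trace_ne_zero h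
    rw [e]; exact ⟨h0, h⟩
  have hLX : ∀ i, Commute P (logicalX i) := fun i =>
    hP.commute (hG'.commute _ (commute_logicalX i)) (by
      rw [logicalX, opX_mul_opX]; exact xOp_isHermitian _)
  have hLZ : ∀ i, Commute P (logicalZ i) := fun i =>
    hP.commute (hG'.commute _ (commute_logicalZ i)) (by
      rw [logicalZ, opZ_mul_opZ]; exact zOp_isHermitian _)
  refine ⟨fun i j => ⟨gaugeX_mem i j, gaugeZ_mem i j, opX_B_mul_opX_B i j, opZ_B_mul_opZ_B i j⟩,
    fun i j => ⟨(hαx i j).1, (hαx i j).2, hαz i j⟩, fun a b c d t => ⟨?_, ?_⟩, ?_⟩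
  · exact mul_physicalHamiltonian_mul hP.mul_self hLX hLZ hαx hαz _ _ _ _
  · rw [(commute_encodedHamiltonian hLX hLZ (a t) (b t) (c t) (d t)).eq, Matrix.mul_assoc,
      hP.mul_self]
  · intro V _ _ B
    refine systemBath_mul_coupling_mul (fun p q => ?_) B
    by_cases hp : p = .Z
    · rw [hp]
      exact mul_mul_eq_zero_of_anticommute hP.isHermitian (xOp_isHermitian 1) hXP
        (xOp_one_mul_pauliAt_Z q)
    · exact mul_mul_eq_zero_of_anticommute hP.isHermitian (zOp_isHermitian 1) hZP
        (zOp_one_mul_pauliAt hp q)
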